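/- Monoids are commutative and written additively. A *face* of a monoid $P$ is a submonoid $F\subseteq P$ such that $p+p'\in F$ implies $p,p'\in F$; $\operatorname{Spec} P$ is the set of faces of $P$ with the topology generated by the sets $U_p=\{F : p\in F\}$, and with the sheaf $\mathcal{M}_P$ of monoids whose sections over $U$ are the functions $F\mapsto s(F)\in F^{-1}P$ ($F\in U$) that are locally of the form $p-f$. A *monoidal space* is a topological space $X$ with a sheaf of monoids $\mathcal{M}_X$; morphisms $X\to Y$ are continuous maps $f$ together with a map of sheaves of monoids $f^{-1}\mathcal{M}_Y\to\mathcal{M}_X$. The category of *locally monoidal spaces* has the same objects, with only those morphisms for which each stalk map $h:\mathcal{M}_{Y,f(x)}\to\mathcal{M}_{X,x}$ is local (if $h(m)$ is a unit, then $m$ is a unit). A *fan* is a locally monoidal space with an open cover by locally monoidal spaces isomorphic to some $\operatorname{Spec} P$; fans form a full subcategory of locally monoidal spaces. For an abelian group $A$, $\mathbb{G}(A)$ is the group object in fans with underlying fan $\operatorname{Spec} A$ and group law $\operatorname{Spec}(A\oplus A)\to\operatorname{Spec} A$ induced by $a\mapsto(a,a)$. A *categorical quotient* of $X$ by an action of $\mathbb{G}(A)$,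 in any of these three categories, is a coequalizer of the action map and the projection $\mathbb{G}(A)\times X\rightrightarrows X$, where the product is formed in the category of fans. **Theorem.** Let $A$ be a torsion abelian group and let $X$ be a fan equipped with an action of the group fan $\mathbb{G}(A)$. Then the categorical quotient $q:X\to Y=X/\mathbb{G}(A)$ of $X$ by $\mathbb{G}(A)$ in the category of monoidal spaces exists, and: 1. $Y$ is a fan and $q$ is a map of fans; 2. $q$ is a homeomorphism on underlying topological spaces; 3. $q$ is also the categorical quotient of $X$ by $\mathbb{G}(A)$ in the category of locally monoidal spaces and in the category of fans; 4. for every monoid $P$ and every open embedding $j:\operatorname{Spec} P\to X$ there is a monoid homomorphism $a:P\to A$ such that $j$ is equivariant for the action $\operatorname{Spec}(A\oplus P)\to\operatorname{Spec} P$ of $\mathbb{G}(A)$ on $\operatorname{Spec} P$ induced by $p\mapsto(a(p),p)$, and, with $P'=\{p\in P : a(p)=0\}$, there is an open embedding $j':\operatorname{Spec} P'\to Y$ with image $q(j(\operatorname{Spec} P))$ such that $q\circ j=j'\circ\pi$, where $\pi:\operatorname{Spec} P\to\operatorname{Spec} P'$ is induced by the inclusion $P'\subseteq P$. -/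

import Mathlib

open CategoryTheory CategoryTheory.Limits TopologicalSpace Opposite AlgebraicGeometry

universe u

namespace Fans

section Colimits

variable {J : Type u} [SmallCategory J] (F : J ⥤ AddCommMonCat.{u})

open Classical in
/-- Generating relation for the colimit of `F`, inside the direct sum of the `F.obj j`. -/
inductive ColimRel : DirectSum J (fun j => F.obj j) → DirectSum J (fun j => F.obj j) → Prop
  | of {i j : J} (f : i ⟶ j) (x : F.obj i) :
      ColimRel (DirectSum.of (fun j => F.obj j) i x)
        (DirectSum.of (fun j => F.obj j) j (F.map f x))

open Classical in
/-- The quotient of the direct sum by the congruence generated by `ColimRel F`, as a cocone. -/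
noncomputable def colimCocone : Cocone F where
  pt := AddCommMonCat.of (addConGen (ColimRel F)).Quotient
  ι :=
    { app := fun j => AddCommMonCat.ofHom
        ((addConGen (ColimRel F)).mk'.comp (DirectSum.of (fun j => F.obj j) j))
      naturality := by
        intro i j f
        ext x
        exact ((AddCon.eq _).2 (AddConGen.Rel.of _ _ (ColimRel.of f x))).symm }

open Classical in
/-- `colimCocone F` is a colimit of `F`. -/
noncomputable def colimCoconeIsColimit : IsColimit (colimCocone F) where
  desc s := AddCommMonCat.ofHom <| (addConGen (ColimRel F)).lift
    (DirectSum.toAddMonoid fun j => (s.ι.app j).hom) <| by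
      refine AddCon.addConGen_le.2 ?_
      rintro _ _ ⟨f, x⟩
      simp [AddCon.ker_rel]
  fac s j := by
    ext x
    exact DirectSum.toAddMonoid_of (β := fun j => F.obj j) (γ := s.pt) (fun j => (s.ι.app j).hom) j x
  uniq s m hm := by
    apply AddCommMonCat.hom_ext
    apply AddCon.hom_ext
    apply DirectSum.addHom_ext
    intro j x
    have h1 := ConcreteCategory.congr_hom (hm j) x
    refine Eq.trans h1 ?_
    symm
    exact DirectSum.toAddMonoid_of (β := fun j => F.obj j) (γ := s.pt) (fun j => (s.ι.app j).hom) j x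

end Colimits

/-- Commutative monoids have colimits, so Mathlib's stalks make sense for sheaves of them. -/
instance : HasColimits AddCommMonCat.{u} where
  has_colimits_of_shape _ _ := { has_colimit := fun F => ⟨⟨colimCocone F, colimCoconeIsColimit F⟩⟩ }

/-- The category of monoidal spaces: topological spaces with a sheaf of (commutative, additively
written) monoids. -/
abbrev MS := SheafedSpace.{u + 1, u, u} AddCommMonCat.{u}

/-- Local maps of monoids: only units are sent to units. (That units are sent to units is
automatic, so this says that the preimage of the units is exactly the units.) -/
def IsLocalMap {M N : Type*} [AddCommMonoid M] [AddCommMonoid N] (h : M →+ N) : Prop :=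
  ∀ m, IsAddUnit (h m) → IsAddUnit m

/-- The morphisms of monoidal spaces that are local on all stalks. -/
def localMor : MorphismProperty MS.{u} := fun _ _ f => ∀ x, IsLocalMap (f.hom.stalkMap x).hom

instance : localMor.{u}.IsMultiplicative where
  id_mem X := by
    intro x s hs
    have h1 := ConcreteCategory.congr_hom (PresheafedSpace.stalkMap.id X.toPresheafedSpace x) s
    exact (congrArg IsAddUnit h1).mp hs
  comp_mem f g hf hg := by
    intro x s hs
    have h1 := ConcreteCategory.congr_hom (PresheafedSpace.stalkMap.comp f.hom g.hom x) s
    exact hg _ _ (hf _ _ ((congrArg IsAddUnit h1).mp hs))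

/-- The category of locally monoidal spaces: its objects are the monoidal spaces, its morphisms are
the morphisms of monoidal spaces which are local on all stalks. -/
abbrev LMS := WideSubcategory localMor.{u}

/-- The (non-full) inclusion of locally monoidal spaces into monoidal spaces. -/
abbrev LMS.toMS : LMS.{u} ⥤ MS.{u} := wideSubcategoryInclusion localMor

/-- A face of a monoid: a submonoid `F` such that `p + q ∈ F` implies `p ∈ F` and `q ∈ F`. -/
structure Face (P : Type u) [AddCommMonoid P] extends AddSubmonoid P where
  mem_of_add_mem' : ∀ p q : P, p + q ∈ carrier → p ∈ carrier ∧ q ∈ carrier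

namespace Face

variable {P Q R : Type u} [AddCommMonoid P] [AddCommMonoid Q] [AddCommMonoid R]

instance : SetLike (Face P) P where
  coe F := F.carrier
  coe_injective := by
    rintro ⟨F, _⟩ ⟨G, _⟩ h
    congr
    exact SetLike.coe_injective h

/-- The basic open set `U_p` of all faces containing `p`. -/
def basicOpen (p : P) : Set (Face P) := {F | p ∈ F}

/-- The Zariski topology on the set of faces; the sets `U_p` form a basis, since
`U_p ∩ U_q = U_{p + q}` and `U_0` is everything. -/
instance : TopologicalSpace (Face P) :=
  TopologicalSpace.generateFrom (Set.range basicOpen)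

/-- The preimage of a face. -/
def comap (h : Q →+ P) (F : Face P) : Face Q where
  toAddSubmonoid := F.toAddSubmonoid.comap h
  mem_of_add_mem' p q hpq := F.mem_of_add_mem' (h p) (h q) (by
    have : h (p + q) ∈ F := hpq
    rwa [map_add] at this)

theorem continuous_comap (h : Q →+ P) : Continuous (comap h) := by
  refine continuous_generateFrom_iff.2 ?_
  rintro _ ⟨q, rfl⟩
  exact TopologicalSpace.isOpen_generateFrom_of_mem ⟨h q, rfl⟩

/-- The localization `F⁻¹P`. -/
abbrev Loc (F : Face P) : Type u := AddLocalization F.toAddSubmonoid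

/-- The map `(h⁻¹F)⁻¹Q → F⁻¹P` induced by `h : Q → P`. -/
noncomputable def locMap (h : Q →+ P) (F : Face P) : (comap h F).Loc →+ F.Loc :=
  (AddLocalization.addMonoidOf (comap h F).toAddSubmonoid).map
    (T := F.toAddSubmonoid) (g := h) (fun y => y.2) (AddLocalization.addMonoidOf F.toAddSubmonoid)

theorem locMap_mk (h : Q →+ P) (F : Face P) (q : Q) (f : (comap h F).toAddSubmonoid) :
    locMap h F (AddLocalization.mk q f) = AddLocalization.mk (h q) ⟨h f, f.2⟩ := by
  rw [AddLocalization.mk_eq_addMonoidOf_mk', AddLocalization.mk_eq_addMonoidOf_mk']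
  exact AddSubmonoid.LocalizationMap.map_mk' _ _ _ _

end Face

namespace Spec

variable (P : Type u) [AddCommMonoid P]

/-- The space of faces of `P`. -/
def top : TopCat.{u} := TopCat.of (Face P)

variable {P} in
/-- The function `s` is given on all of `U` by a single difference `p - f`. -/
def IsFraction {U : Opens (top P)} (s : ∀ F : U, Face.Loc F.1) : Prop :=
  ∃ p f : P, ∀ F : U, ∃ hf : f ∈ F.1.toAddSubmonoid, s F = AddLocalization.mk p ⟨f, hf⟩

/-- `IsFraction` is stable under restriction. -/
def isFractionPrelocal : TopCat.PrelocalPredicate (X := top P) (fun F => Face.Loc F) where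
  pred s := IsFraction s
  res := by
    rintro V U i s ⟨p, f, w⟩
    exact ⟨p, f, fun F => w (i F)⟩

/-- Being locally of the form `p - f`. -/
def isLocallyFraction : TopCat.LocalPredicate (X := top P) (fun F => Face.Loc F) :=
  (isFractionPrelocal P).sheafify

/-- Sections of the structure sheaf over `U`: functions assigning to each face `F` in `U` an element
of `F⁻¹P`, locally of the form `F ↦ p - f`. -/
def sections (U : Opens (top P)) : AddSubmonoid (∀ F : U, Face.Loc F.1) where
  carrier := {s | (isLocallyFraction P).pred s}
  zero_mem' F := ⟨U, F.2, 𝟙 _, 0, 0, fun G => ⟨zero_mem _, (AddLocalization.mk_zero).symm⟩⟩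
  add_mem' {s t} hs ht F := by
    obtain ⟨V, hV, i, p, f, w⟩ := hs F
    obtain ⟨V', hV', i', p', f', w'⟩ := ht F
    refine ⟨V ⊓ V', ⟨hV, hV'⟩, Opens.infLELeft _ _ ≫ i, p + p', f + f', fun G => ?_⟩
    obtain ⟨h1, e1⟩ := w ⟨G.1, G.2.1⟩
    obtain ⟨h2, e2⟩ := w' ⟨G.1, G.2.2⟩
    exact ⟨add_mem h1 h2, congr($e1 + $e2).trans (AddLocalization.mk_add ..)⟩

/-- The structure sheaf of `Spec P`. -/
def presheaf : TopCat.Presheaf AddCommMonCat.{u} (top P) where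
  obj U := AddCommMonCat.of (sections P U.unop)
  map {U V} i := AddCommMonCat.ofHom
    { toFun := fun s => ⟨fun F => s.1 (i.unop F), (isLocallyFraction P).res i.unop _ s.2⟩
      map_zero' := rfl
      map_add' := fun _ _ => rfl }

theorem presheaf_isSheaf : (presheaf P).IsSheaf :=
  (TopCat.Presheaf.isSheaf_iff_isSheaf_comp (forget AddCommMonCat) _).2
    (TopCat.Presheaf.isSheaf_of_iso
      (NatIso.ofComponents fun _ => Iso.refl _ : (TopCat.subsheafToTypes (isLocallyFraction P)).1 ≅ _)
      (TopCat.subsheafToTypes (isLocallyFraction P)).2)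

/-- `Spec P` as a monoidal space. -/
def toMS : MS.{u} where
  carrier := top P
  presheaf := presheaf P
  IsSheaf := presheaf_isSheaf P

variable {P} {Q : Type u} [AddCommMonoid Q] (h : Q →+ P)

/-- `F ↦ h⁻¹F` on spaces. -/
def topMap : top P ⟶ top Q := TopCat.ofHom ⟨Face.comap h, Face.continuous_comap h⟩

/-- The map on sections induced by `h`, through the maps `(h⁻¹F)⁻¹Q → F⁻¹P`. -/
noncomputable def sectionsMap (V : Opens (top Q)) :
    sections Q V →+ sections P ((Opens.map (topMap h)).obj V) where
  toFun s := ⟨fun F => Face.locMap h F.1 (s.1 ⟨Face.comap h F.1, F.2⟩), fun F => by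
    obtain ⟨W, hW, i, q, f, w⟩ := s.2 ⟨Face.comap h F.1, F.2⟩
    refine ⟨(Opens.map (topMap h)).obj W, hW, (Opens.map (topMap h)).map i, h q, h f, fun G => ?_⟩
    obtain ⟨h1, e1⟩ := w ⟨Face.comap h G.1, G.2⟩
    exact ⟨h1, (congrArg (Face.locMap h G.1) e1).trans (Face.locMap_mk h G.1 q ⟨f, h1⟩)⟩⟩
  map_zero' := by
    apply Subtype.ext
    funext F
    exact map_zero (Face.locMap h F.1)
  map_add' s t := by
    apply Subtype.ext
    funext F
    exact map_add (Face.locMap h F.1) _ _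

/-- The morphism of monoidal spaces `Spec P ⟶ Spec Q` induced by `h : Q → P`. -/
noncomputable def msMap : toMS P ⟶ toMS Q := InducedCategory.homMk
  { base := topMap h
    c := { app := fun V => AddCommMonCat.ofHom (sectionsMap h V.unop)
           naturality := fun _ _ _ => rfl } }


/-- The section `p - f` over an open set on which `f` is invertible. -/
def const (p f : P) (U : Opens (top P)) (hU : ∀ F ∈ U, f ∈ F.toAddSubmonoid) : sections P U :=
  ⟨fun F => AddLocalization.mk p ⟨f, hU F F.2⟩, fun F => ⟨U, F.2, 𝟙 _, p, f, fun G => ⟨hU G G.2, rfl⟩⟩⟩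

theorem isOpen_basicOpen (p : P) : IsOpen (Face.basicOpen p) :=
  TopologicalSpace.isOpen_generateFrom_of_mem ⟨p, rfl⟩

/-- If the germ at `F` of a section with value `p - f` at `F` is a unit, then `p ∈ F`. -/
theorem mem_of_isAddUnit_germ {F : top P} {U : Opens (top P)} (hF : F ∈ U) (s : sections P U)
    (p f : P) (hf : f ∈ F.toAddSubmonoid)
    (hs : IsAddUnit ((presheaf P).germ U F hF s)) (e : s.1 ⟨F, hF⟩ = AddLocalization.mk p ⟨f, hf⟩) :
    p ∈ F.toAddSubmonoid := by
  obtain ⟨t, ht⟩ := isAddUnit_iff_exists_neg.1 hs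
  obtain ⟨V, hVU, hV, t, rfl⟩ := (presheaf P).exists_le_germ_eq t hF
  have h1 : (presheaf P).germ V F hV ((presheaf P).map (homOfLE hVU).op s + t) =
      (presheaf P).germ V F hV (0 : sections P V) := by
    refine (map_add ((presheaf P).germ V F hV).hom _ _).trans ?_
    refine Eq.trans ?_ (map_zero ((presheaf P).germ V F hV).hom).symm
    rw [← ht]
    congr 1
    exact (presheaf P).germ_res_apply (homOfLE hVU) F hV s
  obtain ⟨W, hW, i, j, h2⟩ := (presheaf P).germ_eq F hV hV _ _ h1
  have h3 : s.1 ⟨F, hF⟩ + t.1 ⟨F, hV⟩ = 0 := congrFun (congrArg Subtype.val h2) ⟨F, hW⟩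
  rw [e] at h3
  obtain ⟨⟨p', f'⟩, h4⟩ : ∃ y : P × F.toAddSubmonoid, t.1 ⟨F, hV⟩ = AddLocalization.mk y.1 y.2 :=
    AddLocalization.induction_on (t.1 ⟨F, hV⟩) fun y => ⟨y, rfl⟩
  rw [h4, AddLocalization.mk_add, ← AddLocalization.mk_zero, AddLocalization.mk_eq_mk_iff,
    AddLocalization.r_iff_exists] at h3
  obtain ⟨c, hc⟩ := h3
  have h5 : (c : P) + (p + p') ∈ F.toAddSubmonoid := by
    have : (c : P) + (((⟨f, hf⟩ + f' : F.toAddSubmonoid) : P) + 0) ∈ F.toAddSubmonoid :=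
      add_mem c.2 (add_mem (Subtype.property _) (zero_mem _))
    rw [← hc] at this
    simpa using this
  exact (F.mem_of_add_mem' _ _ (F.mem_of_add_mem' _ _ h5).2).1

/-- If a section is given by `p - f` near `F` and `p ∈ F`, then its germ at `F` is a unit. -/
theorem isAddUnit_germ {F : top P} {V : Opens (top P)} (hF : F ∈ V) (s : sections P V)
    (p f : P) (hp : p ∈ F.toAddSubmonoid) (W : Opens (top P)) (hW : F ∈ W) (i : W ⟶ V)
    (w : ∀ G : W, ∃ hf : f ∈ G.1.toAddSubmonoid, s.1 (i G) = AddLocalization.mk p ⟨f, hf⟩) :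
    IsAddUnit ((presheaf P).germ V F hF s) := by
  let U : Opens (top P) := W ⊓ ⟨Face.basicOpen p, isOpen_basicOpen p⟩
  have hU : F ∈ U := ⟨hW, hp⟩
  have hUV : U ≤ V := inf_le_left.trans i.le
  refine isAddUnit_iff_exists_neg.2 ⟨(presheaf P).germ U F hU (const f p U fun G hG => hG.2), ?_⟩
  rw [← (presheaf P).germ_res_apply (homOfLE hUV) F hU s]
  refine (map_add ((presheaf P).germ U F hU).hom _ _).symm.trans ?_
  refine Eq.trans ?_ (map_zero ((presheaf P).germ U F hU).hom)
  congr 1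
  apply Subtype.ext
  funext G
  obtain ⟨h3, e3⟩ := w ⟨G.1, G.2.1⟩
  refine (congrArg (· + AddLocalization.mk f ⟨p, G.2.2⟩) e3).trans ?_
  refine (AddLocalization.mk_add ..).trans ?_
  rw [add_comm p f]
  exact AddLocalization.mk_self (S := G.1.toAddSubmonoid) ⟨f + p, add_mem h3 G.2.2⟩

theorem localMor_msMap : localMor (msMap h) := by
  intro F s hs
  obtain ⟨V, hV, s, rfl⟩ := (presheaf Q).exists_germ_eq s
  have h1 := ConcreteCategory.congr_hom (PresheafedSpace.stalkMap_germ (msMap h).hom V F hV) s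
  have h2 := (congrArg IsAddUnit h1).mp hs
  obtain ⟨W, hW, i, q, f, w⟩ := s.2 ⟨Face.comap h F, hV⟩
  obtain ⟨hf, e⟩ := w ⟨Face.comap h F, hW⟩
  have hq : h q ∈ F.toAddSubmonoid := by
    refine mem_of_isAddUnit_germ (U := (Opens.map (topMap h)).obj V) (F := F) hV
      (sectionsMap h V s) (h q) (h f) hf h2 ?_
    exact (congrArg (Face.locMap h F) e).trans (Face.locMap_mk h F q ⟨f, hf⟩)
  let U : Opens (top Q) := W ⊓ ⟨Face.basicOpen q, isOpen_basicOpen q⟩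
  have hU : Face.comap h F ∈ U := ⟨hW, hq⟩
  have hUV : U ≤ V := inf_le_left.trans i.le
  exact isAddUnit_germ hV s q f hq W hW i w

end Spec

/-- `Spec P` as a locally monoidal space. -/
def Spec (P : Type u) [AddCommMonoid P] : LMS.{u} := ⟨Spec.toMS P⟩

/-- The morphism `Spec P ⟶ Spec Q` induced by `h : Q → P`. -/
noncomputable def Spec.map {P Q : Type u} [AddCommMonoid P] [AddCommMonoid Q] (h : Q →+ P) :
    Spec P ⟶ Spec Q := ⟨Spec.msMap h, Spec.localMor_msMap h⟩

/-- The restriction of a locally monoidal space to an open subset. -/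
noncomputable def LMS.restrict (X : LMS.{u}) (U : Opens X.obj) : LMS.{u} :=
  ⟨X.obj.restrict U.isOpenEmbedding⟩

theorem localMor_iso {X Y : MS.{u}} (e : X ≅ Y) : localMor e.hom := by
  intro x s hs
  have : IsIso e.hom := e.isIso_hom
  have : IsIso (e.hom.hom.stalkMap x) := inferInstance
  have h1 := hs.map (inv (e.hom.hom.stalkMap x)).hom
  exact (congrArg IsAddUnit
    (ConcreteCategory.congr_hom (IsIso.hom_inv_id (e.hom.hom.stalkMap x)) s)).mp h1

/-- A locally monoidal space is a fan if it is covered by open subsets that are isomorphic, as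
locally monoidal spaces, to `Spec P` for monoids `P`. -/
def LMS.isFan : ObjectProperty LMS.{u} := fun X =>
  ∀ x : X.obj, ∃ U : Opens X.obj, x ∈ U ∧
    ∃ (P : Type u) (_ : AddCommMonoid P), Nonempty (X.restrict U ≅ Spec P)

/-- The category of fans, a full subcategory of the locally monoidal spaces. -/
abbrev Fan := LMS.isFan.{u}.FullSubcategory

/-- The inclusion of fans into locally monoidal spaces. -/
abbrev Fan.toLMS : Fan.{u} ⥤ LMS.{u} := LMS.isFan.ι

/-- The inclusion of fans into monoidal spaces. -/
abbrev Fan.toMS : Fan.{u} ⥤ MS.{u} := Fan.toLMS ⋙ LMS.toMS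

theorem Spec.isFan (P : Type u) [AddCommMonoid P] : (Spec P).isFan := fun _ =>
  ⟨⊤, trivial, P, inferInstance, ⟨WideSubcategory.isoMk (Spec P).obj.restrictTopIso
      (localMor_iso _) (localMor_iso (Spec P).obj.restrictTopIso.symm)⟩⟩

/-- `Spec P` as a fan. -/
def Fan.spec (P : Type u) [AddCommMonoid P] : Fan.{u} := ⟨Spec P, Spec.isFan P⟩

/-- The map of fans `Spec P ⟶ Spec Q` induced by `h : Q → P`. -/
noncomputable def Fan.specMap {P Q : Type u} [AddCommMonoid P] [AddCommMonoid Q] (h : Q →+ P) :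
    Fan.spec P ⟶ Fan.spec Q := ObjectProperty.homMk (Spec.map h)

section Action

/-- The map `(g, x) : T ⟶ G × X` into a product of fans with components `g` and `x`. -/
def pair {G X T : Fan.{u}} {c : BinaryFan G X} (hc : IsLimit c) (g : T ⟶ G) (x : T ⟶ X) :
    T ⟶ c.pt := hc.lift (BinaryFan.mk g x)

variable (A : Type u) [AddCommGroup A]

/-- The fan underlying the group fan `𝔾(A)`, namely `Spec A`. -/
def GG : Fan.{u} := Fan.spec A

namespace GG

/-- The neutral element `Spec 0 ⟶ 𝔾(A)`; the fan `Spec 0` is the terminal fan. -/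
noncomputable def one : Fan.spec PUnit.{u + 1} ⟶ GG A := Fan.specMap (0 : A →+ PUnit.{u + 1})

/-- The first projection from `𝔾(A) × 𝔾(A) = Spec (A ⊕ A)`, induced by `a ↦ (a, 0)`. -/
noncomputable def fst : Fan.spec (A × A) ⟶ GG A := Fan.specMap (AddMonoidHom.inl A A)

/-- The second projection from `𝔾(A) × 𝔾(A) = Spec (A ⊕ A)`, induced by `a ↦ (0, a)`. -/
noncomputable def snd : Fan.spec (A × A) ⟶ GG A := Fan.specMap (AddMonoidHom.inr A A)

/-- The group law `𝔾(A) × 𝔾(A) = Spec (A ⊕ A) ⟶ 𝔾(A)`, induced by `a ↦ (a, a)`. -/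
noncomputable def mul : Fan.spec (A × A) ⟶ GG A :=
  Fan.specMap ((AddMonoidHom.id A).prod (AddMonoidHom.id A))

end GG

/-- An action of the group fan `𝔾(A)` on a fan `X`: a morphism from a product `𝔾(A) × X` in the
category of fans to `X` which satisfies `1 · x = x` and `(g g') · x = g · (g' · x)` for all points
`x`, `g`, `g'` with values in arbitrary fans `T`. A pair `(g, g')` of `T`-points of `𝔾(A)` is
a morphism `k : T ⟶ Spec (A ⊕ A)`. -/
structure Action (X : Fan.{u}) where
  /-- A product of `𝔾(A)` and `X` in the category of fans. -/
  prod : BinaryFan (GG A) X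
  /-- The universal property of the product. -/
  isLimit : IsLimit prod
  /-- The action morphism `𝔾(A) × X ⟶ X`. -/
  act : prod.pt ⟶ X
  one_act : ∀ (T : Fan.{u}) (t : T ⟶ Fan.spec PUnit.{u + 1}) (x : T ⟶ X),
    pair isLimit (t ≫ GG.one A) x ≫ act = x
  mul_act : ∀ (T : Fan.{u}) (k : T ⟶ Fan.spec (A × A)) (x : T ⟶ X),
    pair isLimit (k ≫ GG.mul A) x ≫ act =
      pair isLimit (k ≫ GG.fst A) (pair isLimit (k ≫ GG.snd A) x ≫ act) ≫ act

variable {A} {X : Fan.{u}}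

/-- The projection `𝔾(A) × X ⟶ X`. -/
def Action.proj (α : Action A X) : α.prod.pt ⟶ X := α.prod.snd

/-- The restriction of the action `α` along `j : Spec P ⟶ X` (an open embedding, in practice) is the
action on `Spec P` given by `a : P → A`, that is, `j` is equivariant for `α` and for
`𝔾(A) × Spec P = Spec (A ⊕ P) ⟶ Spec P` induced by the coaction `p ↦ (a p, p)`. -/
def Action.RestrictsTo (α : Action A X) {P : Type u} [AddCommMonoid P] (j : Fan.spec P ⟶ X)
    (a : P →+ A) : Prop :=
  pair α.isLimit (T := Fan.spec (A × P)) (Fan.specMap (AddMonoidHom.inl A P))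
      (Fan.specMap (AddMonoidHom.inr A P) ≫ j) ≫ α.act =
    Fan.specMap (a.prod (AddMonoidHom.id P)) ≫ j

end Action

/-- `q` is the categorical quotient of `X` by the parallel pair `r, s : R ⟶ X`, i.e. a coequalizer.
For `R = 𝔾(A) × X` with `r` the action and `s` the projection, this is the categorical quotient
of `X` by `𝔾(A)`. -/
def IsQuotient {C : Type*} [Category C] {R X Y : C} (r s : R ⟶ X) (q : X ⟶ Y) : Prop :=
  ∃ w : r ≫ q = s ≫ q, Nonempty (IsColimit (Cofork.ofπ q w))

/-- Open embeddings of fans: open embeddings of spaces which induce isomorphisms of structure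
sheaves. -/
def Fan.IsOpenEmb {X Y : Fan.{u}} (f : X ⟶ Y) : Prop :=
  SheafedSpace.IsOpenImmersion (Fan.toMS.map f)

/-- The continuous map underlying a map of fans, as a function. -/
def Fan.fn {X Y : Fan.{u}} (f : X ⟶ Y) : X.obj.obj → Y.obj.obj := (Fan.toMS.map f).hom.base

end Fans

/-! Elements of `A` are units in `A × P`, so they lie in every face: the faces of `A × P` are
exactly the preimages of faces of `P` under the second projection. Hence the unit section `Spec P ⟶
Spec (A × P)` is surjective on points. By the unit axiom it composes with the action on a chart `j`
to give `j`, so the action preserves the image of `j` and is given there by a homomorphism `P → A ×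
P` with second component the identity, that is, by some `a : P → A` (`Action.exists_restrictsTo`).
It follows that action and projection agree on points (`Action.pt_act_eq`).

For a pair of maps agreeing on points, the coequalizer in monoidal spaces keeps the space and takes
the subsheaf of sections with equal pullbacks. Being this coequalizer can be tested on points and
stalks (`IsGeomQuotient`): homeomorphism, equal composites, injective stalk maps, and every germ of
an invariant section in the image.

Torsion enters through one fact: each `p` has a positive multiple in `P' = ker a`. So `P` and `P'`
have the same faces, localizations of `P'` inject into those of `P`, and an invariant fraction `p -
f`, for which `a p = a f`, equals `(p + n f) - (n + 1) f` with both terms in `P'`. Thus `Spec P ⟶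
Spec P'` is the affine quotient (`Spec.isGeomQuotient_msMap_mker`).

The universal property of the affine quotient gives `Spec P' ⟶ Y`, an open immersion
(`Action.exists_isOpenImmersion`). These charts make `Y` a fan and `q` local; since `q` is
surjective, factorizations of local maps through it are again local, so the quotient persists in the
two smaller categories. -/

namespace Fans

/-! ### Monoidal spaces: germs, stalk maps and open immersions -/

namespace MS

variable {X Y Z : MS.{u}}

/-- Sections of the structure sheaf. -/
abbrev Sec (X : MS.{u}) (U : Opens X.carrier) : Type u := X.presheaf.obj (op U)

/-- The germ of a section. -/
noncomputable def germ {U : Opens X.carrier} (x : X.carrier) (hx : x ∈ U) :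
    Sec X U →+ X.presheaf.stalk x := (X.presheaf.germ U x hx).hom

/-- Restriction of sections. -/
def res {U V : Opens X.carrier} (h : U ≤ V) : Sec X V →+ Sec X U :=
  (X.presheaf.map (homOfLE h).op).hom

/-- The map on points. -/
abbrev pt (f : X ⟶ Y) (x : X.carrier) : Y.carrier := f.hom.base x

/-- The preimage of an open set. -/
abbrev preim (f : X ⟶ Y) (V : Opens Y.carrier) : Opens X.carrier := (Opens.map f.hom.base).obj V

/-- The map on sections. -/
def pull (f : X ⟶ Y) (V : Opens Y.carrier) : Sec Y V →+ Sec X (preim f V) :=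
  (f.hom.c.app (op V)).hom

/-- The germ of the pullback of a section. -/
noncomputable def pullGerm (f : X ⟶ Y) {V : Opens Y.carrier} (x : X.carrier) (hx : pt f x ∈ V) :
    Sec Y V →+ X.presheaf.stalk x :=
  (germ (U := preim f V) x hx).comp (pull f V)

theorem germ_res {U V : Opens X.carrier} (h : U ≤ V) (x : X.carrier) (hx : x ∈ U) (s : Sec X V) :
    germ x hx (res h s) = germ x (h hx) s :=
  X.presheaf.germ_res_apply (homOfLE h) x hx s

theorem exists_res_eq {U V : Opens X.carrier} {x : X.carrier} {hU : x ∈ U} {hV : x ∈ V}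
    {s : Sec X U} {t : Sec X V} (h : germ x hU s = germ x hV t) :
    ∃ (W : Opens X.carrier) (_ : x ∈ W) (iU : W ≤ U) (iV : W ≤ V), res iU s = res iV t := by
  obtain ⟨W, hW, i, j, h⟩ := X.presheaf.germ_eq x hU hV s t h
  exact ⟨W, hW, i.le, j.le, h⟩

theorem exists_germ_eq {x : X.carrier} (t : X.presheaf.stalk x) {V : Opens X.carrier} (hV : x ∈ V) :
    ∃ U ≤ V, ∃ (m : x ∈ U) (s : Sec X U), germ x m s = t :=
  X.presheaf.exists_le_germ_eq t hV

theorem sec_ext {U : Opens X.carrier} {s t : Sec X U} (h : ∀ x hx, germ x hx s = germ x hx t) :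
    s = t :=
  TopCat.Presheaf.section_ext X.sheaf U s t h

theorem pullGerm_eq_stalkMap (f : X ⟶ Y) {V : Opens Y.carrier} (x : X.carrier) (hx : pt f x ∈ V)
    (t : Sec Y V) : pullGerm f x hx t = f.hom.stalkMap x (germ (pt f x) hx t) :=
  (ConcreteCategory.congr_hom (PresheafedSpace.stalkMap_germ f.hom V x hx) t).symm

theorem pullGerm_congr {f g : X ⟶ Y} (h : f = g) {V : Opens Y.carrier} (x : X.carrier)
    (hx : pt f x ∈ V) (hx' : pt g x ∈ V) (t : Sec Y V) :
    pullGerm f x hx t = pullGerm g x hx' t := by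
  subst h; rfl

theorem pullGerm_of_germ_eq (f : X ⟶ Y) {U V : Opens Y.carrier} {x : X.carrier} {hU : pt f x ∈ U}
    {hV : pt f x ∈ V} {s : Sec Y U} {t : Sec Y V} (h : germ (pt f x) hU s = germ (pt f x) hV t) :
    pullGerm f x hU s = pullGerm f x hV t := by
  rw [pullGerm_eq_stalkMap, pullGerm_eq_stalkMap, h]

theorem pullGerm_res (f : X ⟶ Y) {U V : Opens Y.carrier} (h : U ≤ V) (x : X.carrier)
    (hx : pt f x ∈ U) (t : Sec Y V) : pullGerm f x hx (res h t) = pullGerm f x (h hx) t :=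
  pullGerm_of_germ_eq f (germ_res h _ hx t)

/-- Both pulled-back germs live in the stalk of `X` at `x`, so they can be compared without
transport along `pt f x = pt g x`. -/
theorem hom_ext {f g : X ⟶ Y} (h : ∀ x, pt f x = pt g x)
    (h' : ∀ (V : Opens Y.carrier) (t : Sec Y V) (x : X.carrier) (hx : pt f x ∈ V)
      (hx' : pt g x ∈ V), pullGerm f x hx t = pullGerm g x hx' t) : f = g := by
  obtain ⟨⟨b, c⟩⟩ := f
  obtain ⟨⟨b', c'⟩⟩ := g
  obtain rfl : b = b' := by
    ext x
    exact h x
  congr 2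
  ext V t
  exact sec_ext fun x hx => h' V t x hx hx

/-- The map on stalks at `x` is injective, expressed on sections. -/
def InjAt (f : X ⟶ Y) (x : X.carrier) : Prop :=
  ∀ (U V : Opens Y.carrier) (hU : pt f x ∈ U) (hV : pt f x ∈ V) (s : Sec Y U) (t : Sec Y V),
    pullGerm f x hU s = pullGerm f x hV t → germ (pt f x) hU s = germ (pt f x) hV t

/-- The map on stalks at `x` is surjective, expressed on sections. -/
def SurjAt (f : X ⟶ Y) (x : X.carrier) : Prop :=
  ∀ (U : Opens X.carrier) (hU : x ∈ U) (s : Sec X U), ∃ (V : Opens Y.carrier) (hV : pt f x ∈ V)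
    (t : Sec Y V), pullGerm f x hV t = germ x hU s

theorem injAt_iff (f : X ⟶ Y) (x : X.carrier) :
    InjAt f x ↔ Function.Injective (f.hom.stalkMap x) := by
  constructor
  · intro h a b hab
    obtain ⟨U, -, hU, s, rfl⟩ := exists_germ_eq a (V := ⊤) trivial
    obtain ⟨V, -, hV, t, rfl⟩ := exists_germ_eq b (V := ⊤) trivial
    rw [← pullGerm_eq_stalkMap, ← pullGerm_eq_stalkMap] at hab
    exact h _ _ _ _ _ _ hab
  · intro h U V hU hV s t hst
    rw [pullGerm_eq_stalkMap, pullGerm_eq_stalkMap] at hst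
    exact h hst

theorem surjAt_iff (f : X ⟶ Y) (x : X.carrier) :
    SurjAt f x ↔ Function.Surjective (f.hom.stalkMap x) := by
  constructor
  · intro h a
    obtain ⟨U, -, hU, s, rfl⟩ := exists_germ_eq a (V := ⊤) trivial
    obtain ⟨V, hV, t, ht⟩ := h U hU s
    exact ⟨germ _ hV t, by rw [← pullGerm_eq_stalkMap, ht]⟩
  · intro h U hU s
    obtain ⟨a, ha⟩ := h (germ x hU s)
    obtain ⟨V, -, hV, t, rfl⟩ := exists_germ_eq a (V := ⊤) trivial
    exact ⟨V, hV, t, by rw [pullGerm_eq_stalkMap, ha]⟩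

theorem isIso_stalkMap_iff (f : X ⟶ Y) (x : X.carrier) :
    IsIso (f.hom.stalkMap x) ↔ InjAt f x ∧ SurjAt f x := by
  rw [injAt_iff, surjAt_iff, ConcreteCategory.isIso_iff_bijective]
  rfl

theorem isOpenImmersion_iff (f : X ⟶ Y) : SheafedSpace.IsOpenImmersion f ↔
    Topology.IsOpenEmbedding (pt f) ∧ ∀ x, InjAt f x ∧ SurjAt f x := by
  constructor
  · intro h
    exact ⟨h.base_open, fun x => (isIso_stalkMap_iff f x).1
      (SheafedSpace.IsOpenImmersion.stalk_iso f x)⟩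
  · rintro ⟨h, h'⟩
    have (x : X.carrier) : IsIso (f.hom.stalkMap x) := (isIso_stalkMap_iff f x).2 (h' x)
    exact SheafedSpace.IsOpenImmersion.of_stalk_iso f h

theorem isIso_of_bijective (f : X ⟶ Y) (hf : IsHomeomorph (pt f))
    (h : ∀ x, InjAt f x ∧ SurjAt f x) : IsIso f := by
  have : SheafedSpace.IsOpenImmersion f := (isOpenImmersion_iff f).2 ⟨hf.isOpenEmbedding, h⟩
  have : Epi f.hom.base := (TopCat.epi_iff_surjective _).2 hf.surjective
  exact SheafedSpace.IsOpenImmersion.to_iso f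

/-- Locality of the map on stalks at `x`. -/
def LocAt (f : X ⟶ Y) (x : X.carrier) : Prop := IsLocalMap (f.hom.stalkMap x).hom

theorem locAt_iff (f : X ⟶ Y) (x : X.carrier) : LocAt f x ↔
    ∀ (V : Opens Y.carrier) (hV : pt f x ∈ V) (t : Sec Y V),
      IsAddUnit (pullGerm f x hV t) → IsAddUnit (germ (pt f x) hV t) := by
  constructor
  · intro h V hV t ht
    rw [pullGerm_eq_stalkMap] at ht
    exact h _ ht
  · intro h a ha
    obtain ⟨V, -, hV, t, rfl⟩ := exists_germ_eq a (V := ⊤) trivial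
    refine h V hV t ?_
    rw [pullGerm_eq_stalkMap]
    exact ha

theorem locAt_comp {f : X ⟶ Y} {g : Y ⟶ Z} {x : X.carrier} (hf : LocAt f x)
    (hg : LocAt g (pt f x)) : LocAt (f ≫ g) x := by
  rw [locAt_iff] at *
  intro V hV t ht
  exact hg V hV t (hf (preim g V) hV (pull g V t) ht)

theorem isAddUnit_pullGerm (f : X ⟶ Y) {V : Opens Y.carrier} {x : X.carrier} (hV : pt f x ∈ V)
    {t : Sec Y V} (h : IsAddUnit (germ (pt f x) hV t)) : IsAddUnit (pullGerm f x hV t) := by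
  rw [pullGerm_eq_stalkMap]
  exact h.map (f.hom.stalkMap x).hom

theorem LocAt.of_comp {f : X ⟶ Y} {g : Y ⟶ Z} {x : X.carrier} (h : LocAt (f ≫ g) x) :
    LocAt g (pt f x) := by
  rw [locAt_iff] at *
  intro V hV t ht
  exact h V hV t (isAddUnit_pullGerm (V := preim g V) f hV ht)

/-- A germ on `Y` lifts to a germ on `Z`; if it becomes a unit on `X`, the lift is a unit by
locality of the composite, and so is its image on `Y`. -/
theorem LocAt.of_comp_isOpenImmersion {f : X ⟶ Y} {g : Y ⟶ Z} {x : X.carrier}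
    (h : LocAt (f ≫ g) x) (hg : SurjAt g (pt f x)) : LocAt f x := by
  rw [locAt_iff] at *
  intro V hV t ht
  obtain ⟨W, hW, t', e⟩ := hg V hV t
  rw [← e]
  refine isAddUnit_pullGerm g hW (h W hW t' ?_)
  exact (congrArg IsAddUnit (pullGerm_of_germ_eq f (hU := (hW : pt f x ∈ preim g W))
    (hV := hV) e)).mpr ht

theorem locAt_of_injAt_surjAt {f : X ⟶ Y} {x : X.carrier} (h : InjAt f x) (h' : SurjAt f x) :
    LocAt f x := by
  have := (isIso_stalkMap_iff f x).2 ⟨h, h'⟩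
  intro s hs
  have h1 := hs.map (inv (f.hom.stalkMap x)).hom
  exact (congrArg IsAddUnit
    (ConcreteCategory.congr_hom (IsIso.hom_inv_id (f.hom.stalkMap x)) s)).mp h1

theorem localMor_of_isOpenImmersion (f : X ⟶ Y) [SheafedSpace.IsOpenImmersion f] : localMor f :=
  fun x => locAt_of_injAt_surjAt (((isOpenImmersion_iff f).1 ‹_›).2 x).1
    (((isOpenImmersion_iff f).1 ‹_›).2 x).2

/-- Factorization through an open immersion. -/
theorem exists_lift {j : X ⟶ Z} [SheafedSpace.IsOpenImmersion j] (f : Y ⟶ Z)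
    (h : ∀ y, pt f y ∈ Set.range (pt j)) : ∃ l : Y ⟶ X, l ≫ j = f := by
  have : PresheafedSpace.IsOpenImmersion j.hom := ‹_›
  have hr : Set.range f.hom.base ⊆ Set.range j.hom.base := by
    rintro _ ⟨y, rfl⟩
    exact h y
  exact ⟨InducedCategory.homMk (PresheafedSpace.IsOpenImmersion.lift j.hom f.hom hr),
    InducedCategory.hom_ext (PresheafedSpace.IsOpenImmersion.lift_fac j.hom f.hom hr)⟩

end MS

end Fans

/-! ### Coequalizers of maps that agree on points -/

namespace Fans

namespace MS

section Quotient

variable {R X Y Z : MS.{u}} (r s : R ⟶ X)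

/-- The sections on which `r` and `s` agree. -/
def invariants (U : Opens X.carrier) : AddSubmonoid (Sec X U) where
  carrier := {t | ∀ (y : R.carrier) (hr : pt r y ∈ U) (hs : pt s y ∈ U),
    pullGerm r y hr t = pullGerm s y hs t}
  zero_mem' y hr hs := by rw [map_zero, map_zero]
  add_mem' h h' y hr hs := by rw [map_add, map_add, h, h']

variable {r s} in
theorem res_mem_invariants {U V : Opens X.carrier} (h : U ≤ V) {t : Sec X V}
    (ht : t ∈ invariants r s V) : res h t ∈ invariants r s U := fun y hr hs => by
  rw [pullGerm_res, pullGerm_res]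
  exact ht y (h hr) (h hs)

/-- The presheaf of sections on which `r` and `s` agree. -/
def invariantsPresheaf : TopCat.Presheaf AddCommMonCat.{u} X.carrier where
  obj U := AddCommMonCat.of (invariants r s U.unop)
  map i := AddCommMonCat.ofHom <|
    ((res i.unop.le).comp (invariants r s _).subtype).codRestrict _
      fun t => res_mem_invariants i.unop.le t.2
  map_id U := by
    ext t
    exact ConcreteCategory.congr_hom (X.presheaf.map_id U) t.1
  map_comp i j := by
    ext t
    exact ConcreteCategory.congr_hom (X.presheaf.map_comp i j) t.1

/-- The subfunctor of the underlying functor of `X.presheaf` of sections on which `r` and `s`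
agree. -/
def invariantsSubfunctor : Subfunctor (X.presheaf ⋙ forget AddCommMonCat) where
  obj U := {t | t ∈ invariants r s U.unop}
  map i _ ht := res_mem_invariants i.unop.le ht

variable (hrs : ∀ y, pt r y = pt s y)

-- Invariance is a condition at each point `y` of `R`. Because `r y = s y`, a neighbourhood of one
-- is a neighbourhood of the other, so the condition is local on `X` and cuts out a subsheaf.
include hrs in
theorem invariantsPresheaf_isSheaf : (invariantsPresheaf r s).IsSheaf := by
  refine (TopCat.Presheaf.isSheaf_iff_isSheaf_comp (forget AddCommMonCat) _).2 ?_
  refine TopCat.Presheaf.isSheaf_of_iso (F := (invariantsSubfunctor r s).toFunctor)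
    (NatIso.ofComponents fun _ => Iso.refl _) ?_
  have hX : Presieve.IsSheaf _ (X.presheaf ⋙ forget AddCommMonCat) :=
    (isSheaf_iff_isSheaf_of_type _ _).1
      ((TopCat.Presheaf.isSheaf_iff_isSheaf_comp (forget AddCommMonCat) _).1 X.IsSheaf)
  refine (isSheaf_iff_isSheaf_of_type _ _).2
    (((invariantsSubfunctor r s).isSheaf_iff hX).2 fun U t ht y hr hs => ?_)
  obtain ⟨V, i, hV, hy⟩ := ht (pt r y) hr
  have := hV y hy (hrs y ▸ hy)
  exact (pullGerm_res r i.le y hy t).symm.trans (this.trans (pullGerm_res s i.le y _ t))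

/-- The space `X` with the sheaf of sections on which `r` and `s` agree. -/
def quot : MS.{u} where
  carrier := X.carrier
  presheaf := invariantsPresheaf r s
  IsSheaf := invariantsPresheaf_isSheaf r s hrs

/-- The map to the quotient, the identity on spaces. -/
def quotMap : X ⟶ quot r s hrs := InducedCategory.homMk
  { base := 𝟙 _
    c := { app := fun U => AddCommMonCat.ofHom (invariants r s U.unop).subtype
           naturality := fun _ _ _ => rfl } }

/-- `q` is the quotient by `r` and `s`, in terms of spaces and stalks. -/
structure IsGeomQuotient {r s : R ⟶ X} (q : X ⟶ Y) : Prop where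
  isHomeomorph : IsHomeomorph (pt q)
  w : r ≫ q = s ≫ q
  injAt (x : X.carrier) : InjAt q x
  exists_eq (U : Opens X.carrier) (t : Sec X U) (ht : t ∈ invariants r s U) (x : X.carrier)
    (hx : x ∈ U) : ∃ (V : Opens Y.carrier) (hV : pt q x ∈ V) (t' : Sec Y V),
      pullGerm q x hV t' = germ x hx t

theorem quotMap_w : r ≫ quotMap r s hrs = s ≫ quotMap r s hrs :=
  hom_ext hrs fun _ t x hx hx' => t.2 x hx hx'

variable {r s}

theorem isGeomQuotient_quotMap : IsGeomQuotient (r := r) (s := s) (quotMap r s hrs) where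
  isHomeomorph := IsHomeomorph.id
  w := quotMap_w r s hrs
  injAt x U V hU hV t t' h := by
    obtain ⟨W, hW, iU, iV, e⟩ := exists_res_eq (X := X) h
    have e' : res (X := quot r s hrs) iU t = res (X := quot r s hrs) iV t' := Subtype.ext e
    exact (germ_res (X := quot r s hrs) iU x hW t).symm.trans
      ((congrArg _ e').trans (germ_res (X := quot r s hrs) iV x hW t'))
  exists_eq U t ht x hx := ⟨U, hx, ⟨t, ht⟩, rfl⟩

theorem pull_mem_invariants {f : X ⟶ Z} (w : r ≫ f = s ≫ f) (V : Opens Z.carrier) (t : Sec Z V) :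
    pull f V t ∈ invariants r s (preim f V) := fun y hr hs =>
  pullGerm_congr w y hr hs t

/-- The factorization through the quotient. -/
def quotDesc (f : X ⟶ Z) (w : r ≫ f = s ≫ f) : quot r s hrs ⟶ Z := InducedCategory.homMk
  { base := f.hom.base
    c := { app := fun V => AddCommMonCat.ofHom <|
            (pull f V.unop).codRestrict _ fun t => pull_mem_invariants w V.unop t
           naturality := fun U V i => by
            ext t
            exact Subtype.ext (ConcreteCategory.congr_hom (f.hom.c.naturality i) t) } }

theorem eq_quotDesc (f : X ⟶ Z) (w : r ≫ f = s ≫ f) (m : quot r s hrs ⟶ Z)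
    (hm : quotMap r s hrs ≫ m = f) : m = quotDesc hrs f w := by
  subst hm
  rfl

theorem isQuotient_quotMap : IsQuotient r s (quotMap r s hrs) :=
  ⟨quotMap_w r s hrs, ⟨Cofork.IsColimit.mk _ (fun c => quotDesc hrs c.π c.condition)
    (fun _ => rfl) fun c m hm => eq_quotDesc hrs _ c.condition m hm⟩⟩

/-- Quotients are unique up to isomorphism. -/
theorem _root_.Fans.IsQuotient.exists_iso {C : Type*} [Category C] {R X Y Y' : C} {r s : R ⟶ X}
    {q : X ⟶ Y} {q' : X ⟶ Y'} (h : IsQuotient r s q) (h' : IsQuotient r s q') :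
    ∃ e : Y ≅ Y', q ≫ e.hom = q' := by
  obtain ⟨w, ⟨hq⟩⟩ := h
  obtain ⟨w', ⟨hq'⟩⟩ := h'
  exact ⟨hq.coconePointUniqueUpToIso hq',
    hq.comp_coconePointUniqueUpToIso_hom hq' WalkingParallelPair.one⟩

theorem _root_.Fans.IsQuotient.of_iso {C : Type*} [Category C] {R X Y Y' : C} {r s : R ⟶ X}
    {q : X ⟶ Y} (h : IsQuotient r s q) (e : Y ≅ Y') : IsQuotient r s (q ≫ e.hom) := by
  obtain ⟨w, ⟨hq⟩⟩ := h
  refine ⟨by rw [reassoc_of% w], ⟨IsColimit.ofIsoColimit hq ?_⟩⟩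
  exact Cofork.ext e rfl

theorem InjAt.comp {f : X ⟶ Y} {g : Y ⟶ Z} {x : X.carrier} (hf : InjAt f x)
    (hg : InjAt g (pt f x)) : InjAt (f ≫ g) x := fun U V hU hV t t' h =>
  hg U V hU hV t t' (hf (preim g U) (preim g V) hU hV (pull g U t) (pull g V t') h)

-- Any coequalizer is the explicit one followed by an isomorphism, which preserves all four
-- properties.
include hrs in
theorem IsQuotient.isGeomQuotient {q : X ⟶ Y} (h : IsQuotient r s q) :
    IsGeomQuotient (r := r) (s := s) q := by
  obtain ⟨e, rfl⟩ := (isQuotient_quotMap hrs).exists_iso h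
  have he : SheafedSpace.IsOpenImmersion e.hom := inferInstance
  have he' := ((isOpenImmersion_iff _).1 he).2
  have h0 := isGeomQuotient_quotMap hrs
  refine ⟨(TopCat.homeoOfIso ((SheafedSpace.forget _).mapIso e)).isHomeomorph.comp
    h0.isHomeomorph, h.1, fun x => (h0.injAt x).comp (he' _).1, fun U t ht x hx => ?_⟩
  obtain ⟨V, hV, t', e1⟩ := h0.exists_eq U t ht x hx
  obtain ⟨W, hW, t'', e2⟩ := (he' (pt (quotMap r s hrs) x)).2 V hV t'
  exact ⟨W, hW, t'', (pullGerm_of_germ_eq (quotMap r s hrs)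
    (hU := (hW : pt (quotMap r s hrs) x ∈ preim e.hom W)) (hV := hV) e2).trans e1⟩

-- The map from the explicit quotient is a homeomorphism and bijective on stalks: injectivity is
-- inherited from `q`, and surjectivity holds because sections of the explicit quotient are
-- invariant sections, whose germs `q` reaches.
include hrs in
theorem IsGeomQuotient.isQuotient {q : X ⟶ Y} (h : IsGeomQuotient (r := r) (s := s) q) :
    IsQuotient r s q := by
  have h0 := isGeomQuotient_quotMap hrs
  let d : quot r s hrs ⟶ Y := quotDesc hrs q h.w
  have hd : quotMap r s hrs ≫ d = q := rfl
  have : IsIso d := by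
    refine isIso_of_bijective d h.isHomeomorph fun x => ⟨fun U V hU hV t t' e => ?_,
      fun U hU t => ?_⟩
    · exact h.injAt x U V hU hV t t' (pullGerm_of_germ_eq (quotMap r s hrs)
        (U := preim d U) (V := preim d V) (x := x) (hU := hU) (hV := hV) e)
    · obtain ⟨V, hV, t', e⟩ := h.exists_eq U t.1 t.2 x hU
      exact ⟨V, hV, t', h0.injAt x (preim d V) U hV hU (pull d V t') t e⟩
  exact (isQuotient_quotMap hrs).of_iso (asIso d)

end Quotient

end MS

/-- The factorization exists in monoidal spaces; only its locality is at stake. If `q ≫ d` is local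
at `x`, then `d` is local at `q x`, and every point of `Y` has this form. -/
theorem LMS.isQuotient {R X Y : LMS.{u}} {r s : R ⟶ X} {q : X ⟶ Y}
    (h : IsQuotient (LMS.toMS.map r) (LMS.toMS.map s) (LMS.toMS.map q))
    (hq : Function.Surjective (MS.pt (LMS.toMS.map q))) : IsQuotient r s q := by
  obtain ⟨w, ⟨h⟩⟩ := h
  have key (c : Cofork r s) : ∃ d : Y ⟶ c.pt, q ≫ d = c.π := by
    have hc : LMS.toMS.map r ≫ LMS.toMS.map c.π = LMS.toMS.map s ≫ LMS.toMS.map c.π := by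
      rw [← Functor.map_comp, ← Functor.map_comp, c.condition]
    obtain ⟨d, hd⟩ := Cofork.IsColimit.desc' h _ hc
    replace hd : LMS.toMS.map q ≫ d = LMS.toMS.map c.π := hd
    refine ⟨⟨d, fun y => ?_⟩, LMS.toMS.map_injective hd⟩
    obtain ⟨x, rfl⟩ := hq y
    refine MS.LocAt.of_comp (f := LMS.toMS.map q) (g := d) ?_
    rw [hd]
    exact c.π.2 x
  choose d hd using key
  refine ⟨LMS.toMS.map_injective w, ⟨Cofork.IsColimit.mk _ d hd fun c m hm => ?_⟩⟩
  refine LMS.toMS.map_injective (Cofork.IsColimit.hom_ext h ?_)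
  refine ((LMS.toMS.map_comp q m).symm.trans ?_).trans (LMS.toMS.map_comp q (d c))
  rw [hd]
  exact congrArg LMS.toMS.map hm

/-- A full subcategory reflects coequalizers. -/
theorem Fan.isQuotient {R X Y : Fan.{u}} {r s : R ⟶ X} {q : X ⟶ Y}
    (h : IsQuotient (Fan.toLMS.map r) (Fan.toLMS.map s) (Fan.toLMS.map q)) :
    IsQuotient r s q := by
  obtain ⟨w, ⟨h⟩⟩ := h
  have key (c : Cofork r s) : ∃ d : Y ⟶ c.pt, q ≫ d = c.π := by
    have hc : Fan.toLMS.map r ≫ Fan.toLMS.map c.π = Fan.toLMS.map s ≫ Fan.toLMS.map c.π := by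
      rw [← Functor.map_comp, ← Functor.map_comp, c.condition]
    obtain ⟨d, hd⟩ := Cofork.IsColimit.desc' h _ hc
    exact ⟨Fan.toLMS.preimage d, Fan.toLMS.map_injective (by
      rw [Functor.map_comp, Functor.map_preimage]
      exact hd)⟩
  choose d hd using key
  refine ⟨Fan.toLMS.map_injective w, ⟨Cofork.IsColimit.mk _ d hd fun c m hm => ?_⟩⟩
  refine Fan.toLMS.map_injective (Cofork.IsColimit.hom_ext h ?_)
  refine ((Fan.toLMS.map_comp q m).symm.trans ?_).trans (Fan.toLMS.map_comp q (d c))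
  rw [hd]
  exact congrArg Fan.toLMS.map hm

end Fans

/-! ### Faces and localizations -/

namespace Fans

namespace Face

variable {P Q R : Type u} [AddCommMonoid P] [AddCommMonoid Q] [AddCommMonoid R]

theorem ext' {F G : Face P} (h : ∀ p, p ∈ F ↔ p ∈ G) : F = G := SetLike.ext h

theorem mem_comap {h : Q →+ P} {F : Face P} {q : Q} : q ∈ comap h F ↔ h q ∈ F := Iff.rfl

theorem zero_mem (F : Face P) : (0 : P) ∈ F := F.toAddSubmonoid.zero_mem

theorem add_mem (F : Face P) {p q : P} (hp : p ∈ F) (hq : q ∈ F) : p + q ∈ F :=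
  F.toAddSubmonoid.add_mem hp hq

theorem nsmul_mem (F : Face P) {p : P} (hp : p ∈ F) (n : ℕ) : n • p ∈ F :=
  F.toAddSubmonoid.nsmul_mem hp n

theorem mem_of_isAddUnit (F : Face P) {p : P} (hp : IsAddUnit p) : p ∈ F := by
  obtain ⟨q, hq⟩ := isAddUnit_iff_exists_neg.1 hp
  exact (F.mem_of_add_mem' p q (by rw [hq]; exact F.zero_mem)).1

theorem mem_of_nsmul_mem (F : Face P) {p : P} {n : ℕ} (hn : 0 < n) (h : n • p ∈ F) : p ∈ F := by
  obtain ⟨n, rfl⟩ := Nat.exists_eq_add_of_le' hn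
  rw [succ_nsmul] at h
  exact (F.mem_of_add_mem' _ _ h).2

/-- The fraction `p - f` in `F⁻¹P`. -/
abbrev frac {F : Face P} (p f : P) (hf : f ∈ F) : F.Loc := AddLocalization.mk p ⟨f, hf⟩

theorem exists_frac {F : Face P} (x : F.Loc) : ∃ (p f : P) (hf : f ∈ F), x = frac p f hf :=
  AddLocalization.induction_on x fun y => ⟨y.1, y.2, y.2.2, rfl⟩

theorem frac_eq_frac_iff {F : Face P} {p f p' f' : P} {hf : f ∈ F} {hf' : f' ∈ F} :
    frac p f hf = frac p' f' hf' ↔ ∃ c ∈ F, c + (f' + p) = c + (f + p') := by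
  rw [AddLocalization.mk_eq_mk_iff, AddLocalization.r_iff_exists]
  constructor
  · rintro ⟨c, hc⟩
    exact ⟨c, c.2, hc⟩
  · rintro ⟨c, hc, h⟩
    exact ⟨⟨c, hc⟩, h⟩

theorem frac_add_frac {F : Face P} {p f p' f' : P} {hf : f ∈ F} {hf' : f' ∈ F} :
    frac p f hf + frac p' f' hf' = frac (p + p') (f + f') (F.add_mem hf hf') :=
  AddLocalization.mk_add ..

theorem locMap_frac (h : Q →+ P) (F : Face P) (q f : Q) (hf : f ∈ comap h F) :
    locMap h F (frac q f hf) = frac (h q) (h f) hf := locMap_mk h F q ⟨f, hf⟩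

theorem locMap_comp (h : Q →+ P) (g : R →+ Q) (F : Face P) (x : (comap (h.comp g) F).Loc) :
    locMap h F (locMap g (comap h F) x) = locMap (h.comp g) F x := by
  obtain ⟨p, f, hf, rfl⟩ := exists_frac x
  rw [locMap_frac]
  exact (locMap_frac g (comap h F) p f hf ▸ locMap_frac h F (g p) (g f) hf)

theorem locMap_id (F : Face P) (x : F.Loc) : locMap (AddMonoidHom.id P) F x = x := by
  obtain ⟨p, f, hf, rfl⟩ := exists_frac x
  exact locMap_frac (AddMonoidHom.id P) F p f hf

/-- The generating sets `U_p` are closed under enlarging the face, and unions and intersections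
preserve this. Hence the face of units lies in no proper open subset. -/
theorem mem_isOpen_of_le {F G : Face P} (h : ∀ p ∈ F, p ∈ G) {U : Set (Face P)} (hU : IsOpen U)
    (hF : F ∈ U) : G ∈ U := by
  induction hU with
  | basic s hs =>
    obtain ⟨p, rfl⟩ := hs
    exact h p hF
  | univ => trivial
  | inter s t _ _ hs ht => exact ⟨hs hF.1, ht hF.2⟩
  | sUnion S _ ih =>
    obtain ⟨s, hs, hF⟩ := hF
    exact ⟨s, hs, ih s hs hF⟩

/-- The smallest face: the closed point of `Spec P`. -/
def units (P : Type u) [AddCommMonoid P] : Face P where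
  carrier := {p | IsAddUnit p}
  zero_mem' := isAddUnit_zero
  add_mem' := IsAddUnit.add
  mem_of_add_mem' _ _ h := IsAddUnit.add_iff.1 h

theorem mem_units {p : P} : p ∈ units P ↔ IsAddUnit p := Iff.rfl

theorem mem_of_units_mem {U : Set (Face P)} (hU : IsOpen U) (h : units P ∈ U) (F : Face P) :
    F ∈ U := mem_isOpen_of_le (fun _ => F.mem_of_isAddUnit) hU h

/-- `P` is its own localization at the units. -/
noncomputable def unitsEquiv (P : Type u) [AddCommMonoid P] : P ≃+ (units P).Loc :=
  AddEquiv.ofBijective (AddLocalization.addMonoidOf (units P).toAddSubmonoid).toAddMonoidHom <| by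
    constructor
    · intro p p' h
      obtain ⟨c, hc⟩ := (AddLocalization.addMonoidOf (units P).toAddSubmonoid).exists_of_eq h
      exact IsAddUnit.add_left_cancel c.2 hc
    · intro x
      obtain ⟨p, f, hf, rfl⟩ := exists_frac x
      obtain ⟨g, hg⟩ := isAddUnit_iff_exists_neg.1 (mem_units.1 hf)
      refine ⟨p + g, frac_eq_frac_iff.2 ⟨0, zero_mem _, ?_⟩⟩
      rw [zero_add, zero_add, zero_add, add_left_comm, hg, add_zero]

/-- The map from `P` to its localization. -/
def toLoc (F : Face P) : P →+ F.Loc := (AddLocalization.addMonoidOf F.toAddSubmonoid).toAddMonoidHom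

theorem toLoc_apply (F : Face P) (p : P) : F.toLoc p = frac p 0 F.zero_mem := rfl

/-- The elements of `P` that become units in `F⁻¹P` are those of `F`, by the face property. So `Spec
F⁻¹P ⟶ Spec P` sends the closed point to `F`. -/
theorem comap_toLoc_units (F : Face P) : comap F.toLoc (units F.Loc) = F := by
  refine ext' fun p => ?_
  rw [mem_comap, mem_units, toLoc_apply, isAddUnit_iff_exists_neg]
  constructor
  · rintro ⟨x, hx⟩
    obtain ⟨q, f, hf, rfl⟩ := exists_frac x
    rw [frac_add_frac, ← AddLocalization.mk_zero] at hx
    obtain ⟨c, hc, h⟩ := frac_eq_frac_iff.1 hx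
    have h1 : c + (0 + f + 0) ∈ F := by
      simpa using F.add_mem hc hf
    rw [← h] at h1
    exact (F.mem_of_add_mem' _ _ (F.mem_of_add_mem' _ _ (F.mem_of_add_mem' _ _ h1).2).2).1
  · intro hp
    refine ⟨frac 0 p hp, ?_⟩
    rw [frac_add_frac, ← AddLocalization.mk_zero]
    exact frac_eq_frac_iff.2 ⟨0, F.zero_mem, by abel⟩

theorem locMap_toLoc_units_injective (F : Face P) :
    Function.Injective (locMap F.toLoc (units F.Loc)) := by
  intro x y h
  obtain ⟨p, f, hf, rfl⟩ := exists_frac x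
  obtain ⟨p', f', hf', rfl⟩ := exists_frac y
  rw [locMap_frac, locMap_frac] at h
  obtain ⟨c, hc, h⟩ := frac_eq_frac_iff.1 h
  replace h := IsAddUnit.add_left_cancel hc h
  rw [← map_add, ← map_add, toLoc_apply, toLoc_apply] at h
  obtain ⟨c, hc, h⟩ := frac_eq_frac_iff.1 h
  rw [zero_add, zero_add] at h
  exact frac_eq_frac_iff.2 ⟨c, (comap_toLoc_units F).symm ▸ hc, h⟩

end Face

open MS

/-! ### Sections of `Spec P` and maps between spectra -/

namespace Spec

variable {P Q R : Type u} [AddCommMonoid P] [AddCommMonoid Q] [AddCommMonoid R]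

/-- The value at `F` of a section of the structure sheaf. -/
def val {U : Opens (top P)} (F : Face P) (hF : F ∈ U) (s : Sec (toMS P) U) : F.Loc :=
  (show sections P U from s).1 ⟨F, hF⟩

theorem exists_frac {U : Opens (top P)} (F : Face P) (hF : F ∈ U) (s : Sec (toMS P) U) :
    ∃ (W : Opens (top P)) (_ : F ∈ W) (i : W ≤ U) (p f : P), ∀ (G : Face P) (hG : G ∈ W),
      ∃ hf : f ∈ G, val G (i hG) s = Face.frac p f hf := by
  obtain ⟨W, hW, i, p, f, w⟩ := (show sections P U from s).2 ⟨F, hF⟩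
  exact ⟨W, hW, i.le, p, f, fun G hG => w ⟨G, hG⟩⟩

theorem sec_ext {U : Opens (top P)} {s t : Sec (toMS P) U} (h : ∀ F hF, val F hF s = val F hF t) :
    s = t := by
  apply Subtype.ext
  funext F
  exact h F.1 F.2

/-- Equality of two fractions at `F` is witnessed by some `c ∈ F`, and the same `c` witnesses it on
all of `U_c`. This lets stalks be computed in `F⁻¹P`. -/
theorem germ_eq_germ_iff {U V : Opens (top P)} {F : Face P} {hU : F ∈ U} {hV : F ∈ V}
    {s : Sec (toMS P) U} {t : Sec (toMS P) V} :
    germ (X := toMS P) F hU s = germ (X := toMS P) F hV t ↔ val F hU s = val F hV t := by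
  constructor
  · intro h
    obtain ⟨W, hW, iU, iV, e⟩ := exists_res_eq h
    exact congrArg (val F hW) e
  · intro h
    obtain ⟨W, hW, i, p, f, w⟩ := exists_frac F hU s
    obtain ⟨W', hW', i', p', f', w'⟩ := exists_frac F hV t
    obtain ⟨hf, e⟩ := w F hW
    obtain ⟨hf', e'⟩ := w' F hW'
    obtain ⟨c, hc, hc'⟩ := Face.frac_eq_frac_iff.1 (e.symm.trans (h.trans e'))
    let B : Opens (top P) := W ⊓ W' ⊓ ⟨Face.basicOpen c, isOpen_basicOpen c⟩
    have hB : F ∈ B := ⟨⟨hW, hW'⟩, hc⟩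
    have h1 : B ≤ U := fun G hG => i hG.1.1
    have h2 : B ≤ V := fun G hG => i' hG.1.2
    have h3 : res (X := toMS P) h1 s = res (X := toMS P) h2 t := by
      refine sec_ext fun G hG => ?_
      obtain ⟨hf, e⟩ := w G hG.1.1
      obtain ⟨hf', e'⟩ := w' G hG.1.2
      exact e.trans ((Face.frac_eq_frac_iff.2 ⟨c, hG.2, hc'⟩).trans e'.symm)
    exact (germ_res (X := toMS P) h1 F hB s).symm.trans
      ((congrArg _ h3).trans (germ_res (X := toMS P) h2 F hB t))

theorem injAt_msMap {h : Q →+ P} {F : Face P} (hF : Function.Injective (Face.locMap h F)) :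
    InjAt (msMap h) F := fun U V hU hV s t e => by
  refine germ_eq_germ_iff.2 (hF ?_)
  exact germ_eq_germ_iff.1 e

theorem msMap_comp (h : Q →+ P) (g : R →+ Q) : msMap h ≫ msMap g = msMap (h.comp g) :=
  MS.hom_ext (fun _ => rfl) fun _ _ F _ _ => germ_eq_germ_iff.2 (Face.locMap_comp h g F _)

theorem msMap_id : msMap (AddMonoidHom.id P) = 𝟙 (toMS P) :=
  MS.hom_ext (fun _ => rfl) fun _ _ F _ _ => germ_eq_germ_iff.2 (Face.locMap_id F _)

/-- The constant section `p`. -/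
def cst (P : Type u) [AddCommMonoid P] : P →+ Sec (toMS P) ⊤ where
  toFun p := const p 0 ⊤ fun F _ => F.zero_mem
  map_zero' := sec_ext fun _ _ => AddLocalization.mk_zero
  map_add' p q := sec_ext fun F _ => by
    refine Eq.trans ?_ (Face.frac_add_frac (hf := F.zero_mem) (hf' := F.zero_mem)).symm
    exact Face.frac_eq_frac_iff.2 ⟨0, F.zero_mem, by abel⟩

theorem val_cst (p : P) (F : Face P) (hF : F ∈ (⊤ : Opens (top P))) :
    val F hF (cst P p) = Face.frac p 0 F.zero_mem := rfl

theorem isAddUnit_germ_cst_iff (p : P) (F : Face P) :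
    IsAddUnit (germ (X := toMS P) (U := ⊤) F trivial (cst P p)) ↔ p ∈ F :=
  ⟨fun h => mem_of_isAddUnit_germ (F := F) (U := ⊤) trivial (cst P p) p 0 F.zero_mem h rfl,
    fun h => isAddUnit_germ (F := F) (V := ⊤) trivial (cst P p) p 0 h ⊤ trivial (𝟙 _)
      fun G => ⟨Face.zero_mem (show Face P from G.1), rfl⟩⟩

/-- The value of a global section at the closed point. -/
noncomputable def closedVal (P : Type u) [AddCommMonoid P] : Sec (toMS P) ⊤ →+ P :=
  (Face.unitsEquiv P).symm.toAddMonoidHom.comp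
    { toFun := fun s => val (U := ⊤) (Face.units P) trivial s
      map_zero' := rfl
      map_add' := fun _ _ => rfl }

theorem closedVal_cst (p : P) : closedVal P (cst P p) = p :=
  (Face.unitsEquiv P).symm_apply_eq.2 rfl

theorem val_units (s : Sec (toMS P) ⊤) :
    val (U := ⊤) (Face.units P) trivial s = Face.frac (closedVal P s) 0 (Face.zero_mem _) :=
  ((Face.unitsEquiv P).apply_symm_apply _).symm

/-- The two sections agree at the closed point, hence near it, and the only neighbourhood of the
closed point is the whole space. So global sections of `Spec P` are `P`. -/
theorem cst_closedVal (s : Sec (toMS P) ⊤) : cst P (closedVal P s) = s := by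
  obtain ⟨W, hW, iU, iV, e⟩ := exists_res_eq (X := toMS P) (germ_eq_germ_iff (U := ⊤) (V := ⊤)
    (hU := trivial) (hV := trivial) (t := cst P (closedVal P s)).2 (val_units s))
  refine sec_ext fun F hF => ?_
  exact (congrArg (val F (Face.mem_of_units_mem W.2 hW F)) e).symm

/-- The homomorphism on global sections induced by a map of spectra. -/
noncomputable def globalHom (f : toMS Q ⟶ toMS P) : P →+ Q :=
  ((closedVal Q).comp (pull f ⊤)).comp (cst P)

/-- The map on points, as a map on faces. -/
abbrev face (f : toMS Q ⟶ toMS P) (F : Face Q) : Face P := pt f F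

theorem pull_cst (f : toMS Q ⟶ toMS P) (p : P) : pull f ⊤ (cst P p) = cst Q (globalHom f p) :=
  (cst_closedVal _).symm

theorem globalHom_msMap (h : P →+ Q) : globalHom (msMap h) = h := by
  ext p
  refine (congrArg (closedVal Q) ?_).trans (closedVal_cst (h p))
  refine sec_ext fun F _ => ?_
  refine (Face.locMap_frac h F p 0 (Face.zero_mem _)).trans ?_
  refine Eq.trans ?_ (val_cst (h p) F trivial).symm
  exact Face.frac_eq_frac_iff.2 ⟨0, F.zero_mem, by rw [map_zero]⟩

/-- The equation `s = p - g` in subtraction-free form. As `g` is a unit at the image point, it shows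
that `f` is determined on germs by its effect on global sections. -/
theorem pullGerm_add_cst (f : toMS Q ⟶ toMS P) {V : Opens (top P)} {F : Face Q}
    (hV : face f F ∈ V) (s : Sec (toMS P) V) {p g : P} (hg : g ∈ face f F)
    (e : val (face f F) hV s = Face.frac p g hg) :
    pullGerm f F hV s + germ (X := toMS Q) (U := ⊤) F trivial (cst Q (globalHom f g)) =
      germ (X := toMS Q) (U := ⊤) F trivial (cst Q (globalHom f p)) := by
  rw [← pull_cst, ← pull_cst]
  refine (congrArg₂ (· + ·) (pullGerm_eq_stalkMap f F hV s)
    (pullGerm_eq_stalkMap f (V := ⊤) F trivial (cst P g))).trans ?_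
  refine ((map_add (f.hom.stalkMap F).hom _ _).symm.trans ?_).trans
    (pullGerm_eq_stalkMap f (V := ⊤) F trivial (cst P p)).symm
  refine congrArg (f.hom.stalkMap F) ?_
  rw [← germ_res (X := toMS P) le_top (pt f F) hV (cst P g), ← map_add]
  refine germ_eq_germ_iff.2 ?_
  refine (congrArg (· + Face.frac g 0 (Face.zero_mem _)) e).trans ?_
  refine Face.frac_add_frac.trans (Face.frac_eq_frac_iff.2 ⟨0, Face.zero_mem _, ?_⟩)
  abel

/-- Locality fixes the map on points: `p` lies in the image of `F` iff its germ there is a unit, iff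
the germ of its pullback at `F` is a unit, iff `globalHom f p ∈ F`. On germs, cancel the unit in
`pullGerm_add_cst`. -/
theorem msMap_globalHom (f : toMS Q ⟶ toMS P) (hf : localMor f) : msMap (globalHom f) = f := by
  have hpt (F : Face Q) : Face.comap (globalHom f) F = face f F := by
    refine Face.ext' fun p => ?_
    rw [Face.mem_comap]
    refine (isAddUnit_germ_cst_iff (globalHom f p) F).symm.trans
      (Iff.trans ?_ (isAddUnit_germ_cst_iff p (face f F)))
    rw [← pull_cst]
    exact ⟨(locAt_iff f F).1 (hf F) ⊤ trivial _, isAddUnit_pullGerm (V := ⊤) f trivial⟩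
  refine MS.hom_ext hpt fun V t F hx hx' => ?_
  obtain ⟨p, g, hg, e⟩ := Face.exists_frac (val (face f F) hx' t)
  have e' : ∃ hg', val (Face.comap (globalHom f) F) hx t = Face.frac p g hg' := by
    have (G : Face P) (hG : G = face f F) (hx : G ∈ V) : ∃ hg', val G hx t = Face.frac p g hg' := by
      subst hG
      exact ⟨hg, e⟩
    exact this _ (hpt F) hx
  obtain ⟨hg', e'⟩ := e'
  have h1 := pullGerm_add_cst f hx' t hg e
  have h2 := pullGerm_add_cst (msMap (globalHom f)) hx t hg' e'
  rw [globalHom_msMap, ← h1] at h2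
  exact IsAddUnit.add_right_cancel ((isAddUnit_germ_cst_iff _ F).2 hg') h2

end Spec

namespace Fan

variable {P Q R : Type u} [AddCommMonoid P] [AddCommMonoid Q] [AddCommMonoid R]

theorem hom_ext {X Y : Fan.{u}} {f g : X ⟶ Y} (h : Fan.toMS.map f = Fan.toMS.map g) : f = g :=
  Fan.toMS.map_injective h

theorem specMap_comp (h : Q →+ P) (g : R →+ Q) :
    specMap h ≫ specMap g = specMap (h.comp g) := hom_ext (Spec.msMap_comp h g)

theorem specMap_id : specMap (AddMonoidHom.id P) = 𝟙 (spec P) := hom_ext Spec.msMap_id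

theorem specMap_injective {h h' : Q →+ P} (e : specMap h = specMap h') : h = h' := by
  rw [← Spec.globalHom_msMap h, ← Spec.globalHom_msMap h']
  exact congrArg Spec.globalHom (congrArg Fan.toMS.map e)

theorem exists_specMap_eq (f : spec P ⟶ spec Q) : ∃ h : Q →+ P, f = specMap h :=
  ⟨Spec.globalHom (Fan.toMS.map f), hom_ext (Spec.msMap_globalHom (Fan.toMS.map f) f.hom.2).symm⟩

end Fan

end Fans

/-! ### The affine quotient `Spec P ⟶ Spec P'` -/

namespace Fans

open MS

namespace Spec

variable {A P : Type u} [AddCommGroup A] [AddCommMonoid P]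

/-- The two elements differ by the unit `(y - x, 0)`, which lies in every face. -/
theorem prod_mem_iff (G : Face (A × P)) (x y : A) (p : P) : (x, p) ∈ G ↔ (y, p) ∈ G := by
  have key (x y : A) (h : (x, p) ∈ G) : (y, p) ∈ G := by
    have hu : IsAddUnit ((y - x, 0) : A × P) :=
      isAddUnit_iff_exists_neg.2 ⟨(x - y, 0), by simp⟩
    have := G.add_mem (G.mem_of_isAddUnit hu) h
    simpa using this
  exact ⟨key x y, key y x⟩

variable (a : P →+ A)

theorem comap_prod_eq_comap_inr (G : Face (A × P)) :
    Face.comap (a.prod (AddMonoidHom.id P)) G = Face.comap (AddMonoidHom.inr A P) G :=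
  Face.ext' fun p => prod_mem_iff G (a p) 0 p

theorem comap_snd_comap_inr (G : Face (A × P)) :
    Face.comap (AddMonoidHom.snd A P) (Face.comap (AddMonoidHom.inr A P) G) = G :=
  Face.ext' fun x => prod_mem_iff G 0 x.1 x.2

variable (hA : IsAddTorsion A)

-- The place where torsion enters. The form `n + 1` keeps the multiple positive, so that faces can
-- divide by it.
include hA in
theorem exists_nsmul_mem_mker (p : P) : ∃ n : ℕ, (n + 1) • p ∈ AddMonoidHom.mker a := by
  obtain ⟨n, hn, h⟩ := isOfFinAddOrder_iff_nsmul_eq_zero.1 (hA (a p))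
  obtain ⟨n, rfl⟩ := Nat.exists_eq_add_of_le' hn
  exact ⟨n, by rwa [AddMonoidHom.mem_mker, map_nsmul]⟩

-- A face contains `p` iff it contains a positive multiple of `p`, so every `U_p` is pulled back
-- from `Spec P'`; this gives the topology and injectivity. Surjectivity comes from taking radicals.
include hA in
theorem isHomeomorph_comap_mker :
    IsHomeomorph (Face.comap (AddMonoidHom.mker a).subtype : Face P → _) := by
  rw [isHomeomorph_iff_isEmbedding_surjective]
  have key (p : P) : ∃ p' : AddMonoidHom.mker a, ∀ F : Face P,
      p ∈ F ↔ p' ∈ Face.comap (AddMonoidHom.mker a).subtype F := by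
    obtain ⟨n, hn⟩ := exists_nsmul_mem_mker a hA p
    exact ⟨⟨_, hn⟩, fun F => ⟨fun h => F.nsmul_mem h _, F.mem_of_nsmul_mem n.succ_pos⟩⟩
  refine ⟨⟨⟨le_antisymm (Face.continuous_comap _).le_induced (le_generateFrom ?_)⟩, ?_⟩, ?_⟩
  · rintro _ ⟨p, rfl⟩
    obtain ⟨p', hp'⟩ := key p
    exact ⟨_, isOpen_basicOpen p', Set.ext fun F => (hp' F).symm⟩
  · intro F G h
    refine Face.ext' fun p => ?_
    obtain ⟨p', hp'⟩ := key p
    rw [hp', hp', h]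
  · intro F
    have mem {p : P} {n m : ℕ} (hn : (n + 1) • p ∈ AddMonoidHom.mker a)
        (hm : (m + 1) • p ∈ AddMonoidHom.mker a)
        (h : (⟨_, hn⟩ : AddMonoidHom.mker a) ∈ F) : (⟨_, hm⟩ : AddMonoidHom.mker a) ∈ F := by
      refine F.mem_of_nsmul_mem n.succ_pos ?_
      have : (n + 1) • (⟨_, hm⟩ : AddMonoidHom.mker a) = (m + 1) • ⟨_, hn⟩ := by
        apply Subtype.ext
        refine (?_ : (n + 1) • (m + 1) • p = (m + 1) • (n + 1) • p)
        rw [smul_smul, smul_smul, mul_comm]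
      rw [this]
      exact F.nsmul_mem h _
    -- The radical of `F` in `P`: elements with a positive multiple in `F`.
    let G : Face P :=
      { carrier := {p | ∃ (n : ℕ) (h : (n + 1) • p ∈ AddMonoidHom.mker a),
          (⟨_, h⟩ : AddMonoidHom.mker a) ∈ F}
        zero_mem' := ⟨0, by simp, by
          convert F.zero_mem using 1
          exact Subtype.ext (smul_zero _)⟩
        add_mem' := by
          rintro p q ⟨n, hn, hn'⟩ ⟨m, hm, hm'⟩
          -- The multiple is `(n + 1) * (m + 1)`, written as a successor.
          have e : (n * m + n + m + 1) • (p + q) =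
              (m + 1) • (n + 1) • p + (n + 1) • (m + 1) • q := by
            simp only [smul_smul, smul_add]
            congr 2 <;> ring
          have h1 := F.add_mem (F.nsmul_mem hn' (m + 1)) (F.nsmul_mem hm' (n + 1))
          refine ⟨n * m + n + m, ?_, ?_⟩
          · rw [e]
            exact add_mem (nsmul_mem hn _) (nsmul_mem hm _)
          · convert h1 using 1
            exact Subtype.ext e
        mem_of_add_mem' := by
          rintro p q ⟨n, hn, hn'⟩
          obtain ⟨k, hk⟩ := exists_nsmul_mem_mker a hA p
          obtain ⟨l, hl⟩ := exists_nsmul_mem_mker a hA q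
          -- A common multiple that splits into summands each lying in `P'`, where the face property
          -- of `F` applies.
          have e : (k + 1) • (l + 1) • (n + 1) • (p + q) =
              ((l + 1) * (n + 1)) • (k + 1) • p + ((k + 1) * (n + 1)) • (l + 1) • q := by
            simp only [smul_smul, smul_add]
            congr 2 <;> ring
          have h1 := F.nsmul_mem (F.nsmul_mem hn' (l + 1)) (k + 1)
          have h2 : ((l + 1) * (n + 1)) • (⟨_, hk⟩ : AddMonoidHom.mker a) +
              ((k + 1) * (n + 1)) • ⟨_, hl⟩ ∈ F := by
            convert h1 using 1
            exact Subtype.ext e.symm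
          obtain ⟨h3, h4⟩ := F.mem_of_add_mem' _ _ h2
          exact ⟨⟨k, hk, F.mem_of_nsmul_mem (by positivity) h3⟩,
            ⟨l, hl, F.mem_of_nsmul_mem (by positivity) h4⟩⟩ }
    refine ⟨G, Face.ext' fun p => ⟨?_, fun hp => ?_⟩⟩
    · rintro ⟨n, hn, h⟩
      have h0 : (0 + 1) • (p : P) ∈ AddMonoidHom.mker a := by
        rw [zero_add, one_smul]
        exact p.2
      convert mem hn h0 h using 1
      exact Subtype.ext (by simp)
    · refine ⟨0, ?_, ?_⟩
      · rw [zero_add, one_smul]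
        exact p.2
      · convert hp using 1
        exact Subtype.ext (by simp)

-- An equality of fractions witnessed by `c` is also witnessed by any multiple of `c`, and some
-- positive multiple lies in `P'`.
include hA in
theorem locMap_mker_injective (F : Face P) :
    Function.Injective (Face.locMap (AddMonoidHom.mker a).subtype F) := by
  intro x y h
  obtain ⟨p, f, hf, rfl⟩ := Face.exists_frac x
  obtain ⟨p', f', hf', rfl⟩ := Face.exists_frac y
  rw [Face.locMap_frac, Face.locMap_frac] at h
  obtain ⟨c, hc, h⟩ := Face.frac_eq_frac_iff.1 h
  obtain ⟨n, hn⟩ := exists_nsmul_mem_mker a hA c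
  refine Face.frac_eq_frac_iff.2 ⟨⟨_, hn⟩, F.nsmul_mem hc _, Subtype.ext ?_⟩
  refine (?_ : (n + 1) • c + ((f' : P) + p) = (n + 1) • c + ((f : P) + p'))
  rw [succ_nsmul, add_assoc, add_assoc]
  exact congrArg (n • c + ·) h

theorem eq_of_frac_eq {G : Face (A × P)} {p f : P} {hf : (a f, f) ∈ G} {hf' : (0, f) ∈ G}
    (h : Face.frac (a p, p) (a f, f) hf = Face.frac (0, p) (0, f) hf') : a p = a f := by
  obtain ⟨c, -, h⟩ := Face.frac_eq_frac_iff.1 h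
  have := congrArg Prod.fst h
  simpa using this

include hA in
theorem isGeomQuotient_msMap_mker :
    IsGeomQuotient (r := msMap (a.prod (AddMonoidHom.id P))) (s := msMap (AddMonoidHom.inr A P))
      (msMap (AddMonoidHom.mker a).subtype) where
  isHomeomorph := isHomeomorph_comap_mker a hA
  w := by
    rw [msMap_comp, msMap_comp]
    congr 1
    ext p
    · exact AddMonoidHom.mem_mker.1 p.2
    · rfl
  injAt F := injAt_msMap (locMap_mker_injective a hA F)
  exists_eq U t ht F hF := by
    obtain ⟨W, hW, i, p, f, w⟩ := exists_frac F hF t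
    -- The point of `Spec (A × P)` over `F`: both the action and the projection send it to `F`, so
    -- invariance of `p - f` can be read off there.
    let G : Face (A × P) := Face.comap (AddMonoidHom.snd A P) F
    have h1 : Face.comap (AddMonoidHom.inr A P) G ∈ W := hW
    have h2 : Face.comap (a.prod (AddMonoidHom.id P)) G ∈ W := hW
    obtain ⟨hf, e⟩ := w _ h1
    obtain ⟨hf', e'⟩ := w _ h2
    have hG := germ_eq_germ_iff.1 (ht G (i h2) (i h1))
    have hG' := ((congrArg (Face.locMap (a.prod (AddMonoidHom.id P)) G) e').symm.trans hG).trans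
      (congrArg (Face.locMap (AddMonoidHom.inr A P) G) e)
    rw [Face.locMap_frac, Face.locMap_frac] at hG'
    have hpf : a p = a f := eq_of_frac_eq a hG'
    -- Rewrite `p - f` as `(p + n f) - (n + 1) f`. The denominator is in `P'` by choice of `n`, and
    -- the numerator has the same value under `a`, since `a p = a f`.
    obtain ⟨n, hn⟩ := exists_nsmul_mem_mker a hA f
    have hp : p + n • f ∈ AddMonoidHom.mker a := by
      rw [AddMonoidHom.mem_mker] at hn ⊢
      rw [map_add, hpf, ← hn, succ_nsmul', map_add]
    have hfF : f ∈ (show Face P from F) := hf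
    let f' : AddMonoidHom.mker a := ⟨_, hn⟩
    let p' : AddMonoidHom.mker a := ⟨_, hp⟩
    have hf'F : f' ∈ Face.comap (AddMonoidHom.mker a).subtype F := F.nsmul_mem hfF _
    let V : Opens (top (AddMonoidHom.mker a)) := ⟨Face.basicOpen f', isOpen_basicOpen f'⟩
    refine ⟨V, hf'F, const p' f' V fun _ h => h, germ_eq_germ_iff.2 ?_⟩
    obtain ⟨hf'', e''⟩ := w F hW
    refine Eq.trans ?_ e''.symm
    refine (Face.locMap_frac (AddMonoidHom.mker a).subtype F p' f' hf'F).trans ?_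
    refine Face.frac_eq_frac_iff.2 ⟨0, F.zero_mem, ?_⟩
    refine (?_ : 0 + (f + (p + n • f)) = 0 + ((n + 1) • f + p))
    rw [succ_nsmul]
    abel

end Spec

end Fans

/-! ### Affine charts and points of fans -/

namespace Fans

open MS

namespace MS

theorem pt_congr {X Y : MS.{u}} {f g : X ⟶ Y} (h : f = g) (x : X.carrier) : pt f x = pt g x := by
  rw [h]

theorem InjAt.of_comp {X Y Z : MS.{u}} {f : X ⟶ Y} {g : Y ⟶ Z} {x : X.carrier}
    (h : InjAt (f ≫ g) x) : InjAt g (pt f x) := fun U V hU hV _ _ e =>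
  h U V hU hV _ _ (pullGerm_of_germ_eq f (U := preim g U) (V := preim g V) (hU := hU)
    (hV := hV) e)

theorem germ_eq_of_res_eq {X : MS.{u}} {U V W : Opens X.carrier} {iU : W ≤ U} {iV : W ≤ V}
    {s : Sec X U} {t : Sec X V} (h : res iU s = res iV t) (x : X.carrier) (hx : x ∈ W) :
    germ x (iU hx) s = germ x (iV hx) t := by
  rw [← germ_res iU x hx, h, germ_res]

theorem isFan_of_exists_isOpenImmersion {Y : MS.{u}}
    (h : ∀ y : Y.carrier, ∃ (P : Type u) (_ : AddCommMonoid P) (j : Spec.toMS P ⟶ Y),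
      SheafedSpace.IsOpenImmersion j ∧ y ∈ Set.range (pt j)) : LMS.isFan (⟨Y⟩ : LMS.{u}) := by
  intro y
  obtain ⟨P, _, j, hj, hy⟩ := h y
  have : PresheafedSpace.IsOpenImmersion j.hom := hj
  let U : Opens Y.carrier := ⟨Set.range (pt j), hj.base_open.isOpen_range⟩
  let i : Y.restrict U.isOpenEmbedding ⟶ Y := SheafedSpace.ofRestrict Y U.isOpenEmbedding
  have : PresheafedSpace.IsOpenImmersion i.hom :=
    PresheafedSpace.IsOpenImmersion.ofRestrict Y.toPresheafedSpace U.isOpenEmbedding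
  have hr : Set.range i.hom.base = Set.range j.hom.base := Subtype.range_coe
  let e : Y.restrict U.isOpenEmbedding ≅ Spec.toMS P :=
    SheafedSpace.isoMk (PresheafedSpace.IsOpenImmersion.isoOfRangeEq i.hom j.hom hr)
  exact ⟨U, hy, P, _, ⟨WideSubcategory.isoMk e (localMor_iso e) (localMor_iso e.symm)⟩⟩

end MS

namespace Fan

variable {X : Fan.{u}} {P Q : Type u} [AddCommMonoid P] [AddCommMonoid Q]

theorem exists_isOpenEmb (x : X.obj.obj) : ∃ (P : Type u) (_ : AddCommMonoid P)
    (j : spec P ⟶ X), IsOpenEmb j ∧ x ∈ Set.range (pt (toMS.map j)) := by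
  obtain ⟨U, hx, P, _, ⟨e⟩⟩ := X.2 x
  let e' : X.obj.obj.restrict U.isOpenEmbedding ≅ Spec.toMS P := LMS.toMS.mapIso e
  let i : X.obj.obj.restrict U.isOpenEmbedding ⟶ X.obj.obj :=
    SheafedSpace.ofRestrict X.obj.obj U.isOpenEmbedding
  have : SheafedSpace.IsOpenImmersion i :=
    PresheafedSpace.IsOpenImmersion.ofRestrict X.obj.obj.toPresheafedSpace U.isOpenEmbedding
  have hj : SheafedSpace.IsOpenImmersion (e'.inv ≫ i) :=
    SheafedSpace.IsOpenImmersion.comp e'.inv i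
  exact ⟨P, _, ObjectProperty.homMk ⟨e'.inv ≫ i, @localMor_of_isOpenImmersion _ _ _ hj⟩, hj,
    pt e'.hom (show U from ⟨x, hx⟩),
    pt_congr (e'.hom_inv_id_assoc i) (show U from ⟨x, hx⟩)⟩

/-- Every point of a fan is the image of the closed point of a spectrum, with an injective map on
stalks. -/
theorem exists_closedPoint (x : X.obj.obj) : ∃ (Q : Type u) (_ : AddCommMonoid Q)
    (l : spec Q ⟶ X), pt (toMS.map l) (Face.units Q) = x ∧
      InjAt (toMS.map l) (Face.units Q) := by
  obtain ⟨P, _, j, hj, F, rfl⟩ := exists_isOpenEmb x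
  let F' : Face P := F
  refine ⟨F'.Loc, inferInstance, specMap F'.toLoc ≫ j,
    congrArg (pt (toMS.map j)) (Face.comap_toLoc_units F'), ?_⟩
  exact InjAt.comp (f := Spec.msMap F'.toLoc) (g := toMS.map j)
    (Spec.injAt_msMap (Face.locMap_toLoc_units_injective F')) (((isOpenImmersion_iff _).1 hj).2 _).1

/-- The preimage of the image of `j` is an open set containing the closed point, hence all of `Spec
Q`. The resulting lift is local, so it comes from a homomorphism. -/
theorem exists_specMap_comp_eq {j : spec P ⟶ X} (hj : IsOpenEmb j) (f : spec Q ⟶ X)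
    (hf : pt (toMS.map f) (Face.units Q) ∈ Set.range (pt (toMS.map j))) :
    ∃ h : P →+ Q, specMap h ≫ j = f := by
  have hj' : SheafedSpace.IsOpenImmersion (toMS.map j) := hj
  have hr (F : Face Q) : pt (toMS.map f) F ∈ Set.range (pt (toMS.map j)) :=
    Face.mem_of_units_mem (hj'.base_open.isOpen_range.preimage
      (toMS.map f).hom.base.hom.continuous) hf F
  obtain ⟨l, hl⟩ := exists_lift (toMS.map f) hr
  have hloc : localMor l := fun F => LocAt.of_comp_isOpenImmersion (f := l) (g := toMS.map j)
    (by rw [hl]; exact f.hom.2 F) (((isOpenImmersion_iff _).1 hj).2 _).2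
  let l' : spec Q ⟶ spec P := ObjectProperty.homMk ⟨l, hloc⟩
  obtain ⟨h, hh⟩ := exists_specMap_eq l'
  exact ⟨h, by rw [← hh]; exact hom_ext hl⟩

theorem specMap_comp_injective {j : spec P ⟶ X} (hj : IsOpenEmb j) {h h' : P →+ Q}
    (e : specMap h ≫ j = specMap h' ≫ j) : h = h' := by
  have hj' : SheafedSpace.IsOpenImmersion (toMS.map j) := hj
  refine specMap_injective (hom_ext ((cancel_mono (toMS.map j)).1 ?_))
  exact congrArg toMS.map e

end Fan

section Pair

variable {G X T S : Fan.{u}} {c : BinaryFan G X} (hc : IsLimit c)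

theorem pair_fst (g : T ⟶ G) (x : T ⟶ X) : pair hc g x ≫ c.fst = g :=
  hc.fac _ ⟨WalkingPair.left⟩

theorem pair_snd (g : T ⟶ G) (x : T ⟶ X) : pair hc g x ≫ c.snd = x :=
  hc.fac _ ⟨WalkingPair.right⟩

include hc in
theorem pair_hom_ext {f f' : T ⟶ c.pt} (h : f ≫ c.fst = f' ≫ c.fst)
    (h' : f ≫ c.snd = f' ≫ c.snd) : f = f' := BinaryFan.IsLimit.hom_ext hc h h'

end Pair

/-! ### The action in charts, and the open charts of the quotient -/

namespace Action

variable {A : Type u} [AddCommGroup A] {X : Fan.{u}} (α : Action A X)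
  {P : Type u} [AddCommMonoid P] {j : Fan.spec P ⟶ X}

/-- The map `Spec (A ⊕ P) = 𝔾(A) × Spec P ⟶ 𝔾(A) × X`. -/
noncomputable def chart (j : Fan.spec P ⟶ X) : Fan.spec (A × P) ⟶ α.prod.pt :=
  pair α.isLimit (Fan.specMap (AddMonoidHom.inl A P)) (Fan.specMap (AddMonoidHom.inr A P) ≫ j)

theorem chart_fst : α.chart j ≫ α.prod.fst = Fan.specMap (AddMonoidHom.inl A P) :=
  pair_fst ..

theorem chart_proj : α.chart j ≫ α.proj = Fan.specMap (AddMonoidHom.inr A P) ≫ j :=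
  pair_snd ..

/-- The projection `A × P → P` induces the unit section `x ↦ (1, x)`, so this is the unit axiom at
the point `j`. -/
theorem specMap_snd_chart_act : Fan.specMap (AddMonoidHom.snd A P) ≫ α.chart j ≫ α.act = j := by
  have h := α.one_act (Fan.spec P) (Fan.specMap (0 : PUnit.{u + 1} →+ P)) j
  refine Eq.trans ?_ h
  rw [← Category.assoc]
  congr 1
  refine pair_hom_ext α.isLimit ?_ ?_
  · rw [pair_fst, Category.assoc]
    refine (congrArg (Fan.specMap (AddMonoidHom.snd A P) ≫ ·) α.chart_fst).trans ?_
    refine (Fan.specMap_comp _ _).trans (Eq.trans ?_ (Fan.specMap_comp _ _).symm)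
    congr 1
  · rw [pair_snd, Category.assoc]
    refine (congrArg (Fan.specMap (AddMonoidHom.snd A P) ≫ ·) α.chart_proj).trans ?_
    rw [← Category.assoc, Fan.specMap_comp, AddMonoidHom.snd_comp_inr, Fan.specMap_id,
      Category.id_comp]

/-- The closed point of `Spec (A × P)` is in the image of the unit section, so the action sends it
into the image of `j`. The action on the chart therefore comes from some `h : P → A × P`; the unit
axiom forces its second component to be the identity, and `a` is the first. -/
theorem exists_restrictsTo (hj : Fan.IsOpenEmb j) : ∃ a : P →+ A, α.RestrictsTo j a := by
  obtain ⟨h, hh⟩ := Fan.exists_specMap_comp_eq hj (α.chart j ≫ α.act) (by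
    refine ⟨Face.comap (AddMonoidHom.inr A P) (Face.units _), ?_⟩
    rw [← Spec.comap_snd_comap_inr (Face.units (A × P))]
    exact pt_congr (congrArg Fan.toMS.map α.specMap_snd_chart_act.symm)
      (Face.comap (AddMonoidHom.inr A P) (Face.units (A × P))))
  have h1 : (AddMonoidHom.snd A P).comp h = AddMonoidHom.id P := by
    refine Fan.specMap_comp_injective hj ?_
    rw [← Fan.specMap_comp, Category.assoc, hh, specMap_snd_chart_act, Fan.specMap_id,
      Category.id_comp]
  refine ⟨(AddMonoidHom.fst A P).comp h, hh.symm.trans ?_⟩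
  congr 2
  ext p
  · rfl
  · exact DFunLike.congr_fun h1 p

/-- The product is known only by its universal property. A point of it is the image of the closed
point of some `Spec Q`, whose two components come from homomorphisms `A → Q` and `P → Q`, so the map
factors through `Spec (A × P)`. Injectivity on stalks lets equalities of germs on the product be
tested on the chart. -/
theorem exists_chart_eq (hj : Fan.IsOpenEmb j) (y : α.prod.pt.obj.obj)
    (hy : pt (Fan.toMS.map α.proj) y ∈ Set.range (pt (Fan.toMS.map j))) :
    ∃ G : Face (A × P), pt (Fan.toMS.map (α.chart j)) G = y ∧
      InjAt (Fan.toMS.map (α.chart j)) G := by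
  obtain ⟨Q, _, l, rfl, hl⟩ := Fan.exists_closedPoint y
  obtain ⟨h, hh⟩ := Fan.exists_specMap_comp_eq hj (l ≫ α.proj) hy
  obtain ⟨g, hg⟩ := Fan.exists_specMap_eq (P := Q) (Q := A) (l ≫ α.prod.fst)
  have hm : Fan.specMap (g.coprod h) ≫ α.chart j = l := by
    refine pair_hom_ext α.isLimit ?_ ?_
    · rw [Category.assoc]
      refine (congrArg (Fan.specMap (g.coprod h) ≫ ·) α.chart_fst).trans ?_
      refine (Fan.specMap_comp _ _).trans (Eq.trans ?_ hg.symm)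
      rw [AddMonoidHom.coprod_comp_inl]
    · refine Eq.trans ?_ hh
      rw [Category.assoc]
      refine (congrArg (Fan.specMap (g.coprod h) ≫ ·) α.chart_proj).trans ?_
      rw [← Category.assoc, Fan.specMap_comp, AddMonoidHom.coprod_comp_inr]
  subst hm
  exact ⟨_, rfl, InjAt.of_comp (f := Spec.msMap (g.coprod h)) hl⟩

theorem pt_act_eq (y : α.prod.pt.obj.obj) :
    pt (Fan.toMS.map α.act) y = pt (Fan.toMS.map α.proj) y := by
  obtain ⟨P, _, j, hj, hy⟩ := Fan.exists_isOpenEmb (pt (Fan.toMS.map α.proj) y)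
  obtain ⟨a, ha⟩ := α.exists_restrictsTo hj
  obtain ⟨G, rfl, -⟩ := α.exists_chart_eq hj y hy
  have h1 := pt_congr (congrArg Fan.toMS.map ha) G
  have h2 := pt_congr (congrArg Fan.toMS.map (α.chart_proj (j := j))) G
  exact (h1.trans (congrArg (pt (Fan.toMS.map j)) (Spec.comap_prod_eq_comap_inr a G))).trans h2.symm

variable {Y : MS.{u}} {q : Fan.toMS.obj X ⟶ Y} (hA : IsAddTorsion A)
  (hq : IsGeomQuotient (r := Fan.toMS.map α.act) (s := Fan.toMS.map α.proj) q)

include hq in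
theorem restrict_w {a : P →+ A} (ha : α.RestrictsTo j a) :
    Spec.msMap (a.prod (AddMonoidHom.id P)) ≫ Fan.toMS.map j ≫ q =
      Spec.msMap (AddMonoidHom.inr A P) ≫ Fan.toMS.map j ≫ q := by
  have h1 : Fan.toMS.map (α.chart j) ≫ Fan.toMS.map α.act =
    Spec.msMap (a.prod (AddMonoidHom.id P)) ≫ Fan.toMS.map j := congrArg Fan.toMS.map ha
  have h2 : Fan.toMS.map (α.chart j) ≫ Fan.toMS.map α.proj =
    Spec.msMap (AddMonoidHom.inr A P) ≫ Fan.toMS.map j := congrArg Fan.toMS.map α.chart_proj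
  refine (congrArg (· ≫ q) h1).symm.trans (Eq.trans ?_ (congrArg (· ≫ q) h2))
  exact congrArg (Fan.toMS.map (α.chart j) ≫ ·) hq.w

/-- A section over an open set of `X` that comes from the quotient on an affine chart is
invariant. -/
theorem mem_invariants_of_chart (hj : Fan.IsOpenEmb j) {a : P →+ A} (ha : α.RestrictsTo j a)
    {N : Opens (Spec.top P)} {V : Opens X.obj.obj.carrier}
    (hV : ∀ x ∈ V, ∃ F ∈ N, pt (Fan.toMS.map j) F = x)
    {W : Opens (Spec.top (AddMonoidHom.mker a))} (t : Sec X.obj.obj V)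
    (s : Sec (Spec.toMS (AddMonoidHom.mker a)) W)
    (hN : N ≤ preim (Spec.msMap (AddMonoidHom.mker a).subtype) W)
    (h : ∀ (F : Face P) (hF : F ∈ N) (hF' : pt (Fan.toMS.map j) F ∈ V),
      pullGerm (Fan.toMS.map j) F hF' t =
        pullGerm (Spec.msMap (AddMonoidHom.mker a).subtype) F (hN hF) s) :
    t ∈ invariants (Fan.toMS.map α.act) (Fan.toMS.map α.proj) V := by
  intro y hr hs
  obtain ⟨F, hF, hFy⟩ := hV _ hs
  obtain ⟨G, rfl, hG⟩ := α.exists_chart_eq hj y ⟨F, hFy⟩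
  refine hG (preim (Fan.toMS.map α.act) V) (preim (Fan.toMS.map α.proj) V) hr hs
    (pull (Fan.toMS.map α.act) V t) (pull (Fan.toMS.map α.proj) V t) ?_
  let b := a.prod (AddMonoidHom.id P)
  have h1 : Fan.toMS.map (α.chart j) ≫ Fan.toMS.map α.act =
    Spec.msMap b ≫ Fan.toMS.map j := congrArg Fan.toMS.map ha
  have h2 : Fan.toMS.map (α.chart j) ≫ Fan.toMS.map α.proj =
    Spec.msMap (AddMonoidHom.inr A P) ≫ Fan.toMS.map j := congrArg Fan.toMS.map α.chart_proj
  have hpt1 : pt (Fan.toMS.map j) (Face.comap b G) ∈ V :=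
    pt_congr h1 G ▸ hr
  have hpt2 : pt (Fan.toMS.map j) (Face.comap (AddMonoidHom.inr A P) G) ∈ V :=
    pt_congr h2 G ▸ hs
  have mem (F : Face P) (hF : pt (Fan.toMS.map j) F ∈ V) : F ∈ N := by
    obtain ⟨F', hF', e⟩ := hV _ hF
    exact ((isOpenImmersion_iff _).1 hj).1.injective e ▸ hF'
  have key (c : P →+ A × P) (hc : pt (Fan.toMS.map j) (Face.comap c G) ∈ V) :
      pullGerm (Spec.msMap c ≫ Fan.toMS.map j) G hc t =
        pullGerm (Spec.msMap c ≫ Spec.msMap (AddMonoidHom.mker a).subtype) G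
          (hN (mem _ hc)) s :=
    pullGerm_of_germ_eq (Spec.msMap c) (U := preim (Fan.toMS.map j) V)
      (V := preim (Spec.msMap (AddMonoidHom.mker a).subtype) W) (hU := hc) (hV := hN (mem _ hc))
      (h (Face.comap c G) (mem _ hc) hc)
  have hw : Spec.msMap b ≫ Spec.msMap (AddMonoidHom.mker a).subtype =
      Spec.msMap (AddMonoidHom.inr A P) ≫ Spec.msMap (AddMonoidHom.mker a).subtype := by
    rw [Spec.msMap_comp, Spec.msMap_comp]
    congr 1
    ext p
    · exact AddMonoidHom.mem_mker.1 p.2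
    · rfl
  exact (pullGerm_congr h1 G hr hpt1 t).trans <| (key b hpt1).trans <|
    (pullGerm_congr hw G _ _ s).trans <| (key _ hpt2).symm.trans (pullGerm_congr h2 G hs hpt2 t).symm

-- On spaces the map is the open embedding `q ∘ j` preceded by the inverse of a homeomorphism.
-- Stalks inject because those of `j` and `q` do. They surject because a section of `Spec P'` gives
-- an invariant section on an open subset of `X`, which descends to `Y`.
include hA hq in
theorem exists_isOpenImmersion (hj : Fan.IsOpenEmb j) {a : P →+ A} (ha : α.RestrictsTo j a) :
    ∃ j' : Spec.toMS (AddMonoidHom.mker a) ⟶ Y, SheafedSpace.IsOpenImmersion j' ∧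
      Fan.toMS.map j ≫ q = Spec.msMap (AddMonoidHom.mker a).subtype ≫ j' := by
  have hπ := Spec.isGeomQuotient_msMap_mker a hA
  let π := Spec.msMap (AddMonoidHom.mker a).subtype
  obtain ⟨w, ⟨hcolim⟩⟩ := hπ.isQuotient (Spec.comap_prod_eq_comap_inr a)
  obtain ⟨j', hj'⟩ := Cofork.IsColimit.desc' hcolim _ (α.restrict_w hq ha)
  replace hj' : π ≫ j' = Fan.toMS.map j ≫ q := hj'
  refine ⟨j', (isOpenImmersion_iff j').2 ⟨?_, ?_⟩, hj'.symm⟩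
  · obtain ⟨hj1, -⟩ := (isOpenImmersion_iff _).1 hj
    have h1 : Topology.IsOpenEmbedding (pt j' ∘ pt π) := by
      have := hq.isHomeomorph.isOpenEmbedding.comp hj1
      have e : pt j' ∘ pt π = pt q ∘ pt (Fan.toMS.map j) :=
        funext fun F => pt_congr hj' F
      rwa [e]
    have h2 := h1.comp (hπ.isHomeomorph.homeomorph _).symm.isOpenEmbedding
    have e : pt π ∘ (hπ.isHomeomorph.homeomorph _).symm = id :=
      (hπ.isHomeomorph.homeomorph _).self_comp_symm
    rwa [Function.comp_assoc, e] at h2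
  intro F'
  obtain ⟨F, rfl⟩ := hπ.isHomeomorph.surjective F'
  obtain ⟨hj1, hj2⟩ := (isOpenImmersion_iff _).1 hj
  have hpt (F : Face P) : pt j' (pt π F) = pt q (pt (Fan.toMS.map j) F) :=
    pt_congr hj' F
  constructor
  · refine InjAt.of_comp (f := π) ?_
    rw [hj']
    exact (hj2 F).1.comp (hq.injAt _)
  · intro W hW s
    obtain ⟨V, hV, t, ht⟩ := (hj2 F).2 (preim π W) hW (pull π W s)
    obtain ⟨N, hF, iN, iN', hN⟩ := exists_res_eq (X := Spec.toMS P)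
      (U := preim (Fan.toMS.map j) V) (hU := hV) ht
    -- Shrink `V` into `j(N)`, where `t` is the pullback of `s`: every point is then seen in the
    -- chart, and `t` is invariant there.
    let V' : Opens X.obj.obj.carrier :=
      V ⊓ ⟨pt (Fan.toMS.map j) '' (show Opens (Fan.toMS.obj (Fan.spec P)).carrier from N), hj1.isOpenMap _ N.2⟩
    have hV' : V' ≤ V := inf_le_left
    have hinv := α.mem_invariants_of_chart hj ha (N := N) (V := V')
      (fun x hx => hx.2) (res hV' t) s iN' fun G hG hG' =>
        (pullGerm_res (Fan.toMS.map j) hV' G hG' t).trans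
          (germ_eq_of_res_eq (X := Spec.toMS P) hN G hG)
    obtain ⟨B, hB, t', e⟩ := hq.exists_eq V' _ hinv (pt (Fan.toMS.map j) F) ⟨hV, F, hF, rfl⟩
    have hB' : pt j' (pt π F) ∈ B := (hpt F).symm ▸ hB
    -- The stalk of `Spec P'` injects into that of `Spec P`, so the germs of the descended section
    -- and of `s` may be compared at `F`.
    refine ⟨B, hB', t', hπ.injAt F (preim j' B) W hB' hW (pull j' B t') s ?_⟩
    refine (pullGerm_congr hj' F hB' hB t').trans ?_
    refine Eq.trans (pullGerm_of_germ_eq (Fan.toMS.map j) (U := preim q B) (V := V') (hU := hB)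
      (hV := ⟨hV, F, hF, rfl⟩) e) ?_
    exact (pullGerm_res (Fan.toMS.map j) hV' F _ t).trans ht

end Action

end Fans

theorem mainTheorem11 {A : Type u} [AddCommGroup A] (hA : IsAddTorsion A)
    {X : Fans.Fan.{u}} (α : Fans.Action A X) :
    -- the categorical quotient exists in monoidal spaces
    (∃ (Y : Fans.MS.{u}) (q : Fans.Fan.toMS.obj X ⟶ Y),
      Fans.IsQuotient (Fans.Fan.toMS.map α.act) (Fans.Fan.toMS.map α.proj) q) ∧
    -- and every such quotient `q : X ⟶ Y` has the following properties
    ∀ (Y : Fans.MS.{u}) (q : Fans.Fan.toMS.obj X ⟶ Y),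
      Fans.IsQuotient (Fans.Fan.toMS.map α.act) (Fans.Fan.toMS.map α.proj) q →
      -- it is a map of fans
      ∃ (hY : Fans.LMS.isFan (⟨Y⟩ : Fans.LMS.{u})) (hq : Fans.localMor q),
        let Y' : Fans.Fan.{u} := ⟨⟨Y⟩, hY⟩
        let q' : X ⟶ Y' := ObjectProperty.homMk ⟨q, hq⟩
        -- a homeomorphism on spaces
        IsHomeomorph q.hom.base ∧
        -- the quotient in locally monoidal spaces and in fans
        Fans.IsQuotient (Fans.Fan.toLMS.map α.act) (Fans.Fan.toLMS.map α.proj)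
          (Fans.Fan.toLMS.map q') ∧
        Fans.IsQuotient α.act α.proj q' ∧
        -- on each open affine `Spec P` of `X` the action is given by some `a : P → A`, and the
        -- quotient is `Spec P ⟶ Spec P'`, `P' = {p | a p = 0}`, onto an open affine of `Y`
        ∀ (P : Type u) [AddCommMonoid P] (j : Fans.Fan.spec P ⟶ X), Fans.Fan.IsOpenEmb j →
          ∃ a : P →+ A, α.RestrictsTo j a ∧
            ∃ j' : Fans.Fan.spec (AddMonoidHom.mker a) ⟶ Y', Fans.Fan.IsOpenEmb j' ∧
              j ≫ q' = Fans.Fan.specMap (AddMonoidHom.mker a).subtype ≫ j' ∧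
              Set.range (Fans.Fan.fn j') = Fans.Fan.fn q' '' Set.range (Fans.Fan.fn j) := by
  have hrs := α.pt_act_eq
  refine ⟨⟨_, _, Fans.MS.isQuotient_quotMap hrs⟩, fun Y q hq => ?_⟩
  have hgeom := Fans.MS.IsQuotient.isGeomQuotient hrs hq
  have hY : Fans.LMS.isFan (⟨Y⟩ : Fans.LMS.{u}) := by
    refine Fans.MS.isFan_of_exists_isOpenImmersion fun y => ?_
    obtain ⟨x, rfl⟩ := hgeom.isHomeomorph.surjective y
    obtain ⟨P, _, j, hj, F, rfl⟩ := Fans.Fan.exists_isOpenEmb x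
    obtain ⟨a, ha⟩ := α.exists_restrictsTo hj
    obtain ⟨j', hj', e⟩ := α.exists_isOpenImmersion hA hgeom hj ha
    exact ⟨_, _, j', hj', _, (Fans.MS.pt_congr e F).symm⟩
  have hloc : Fans.localMor q := by
    intro x
    obtain ⟨P, _, j, hj, F, rfl⟩ := Fans.Fan.exists_isOpenEmb x
    obtain ⟨a, ha⟩ := α.exists_restrictsTo hj
    obtain ⟨j', hj', e⟩ := α.exists_isOpenImmersion hA hgeom hj ha
    -- Locality of `q` at `j F` follows from that of `j ≫ q`, which is a map of spectra followed by
    -- an open immersion.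
    refine Fans.MS.LocAt.of_comp (f := Fans.Fan.toMS.map j) (g := q) ?_
    rw [e]
    exact Fans.MS.locAt_comp (Fans.Spec.localMor_msMap _ F)
      (Fans.MS.localMor_of_isOpenImmersion j' _)
  refine ⟨hY, hloc, ?_⟩
  intro Y' q'
  have hL : Fans.IsQuotient (Fans.Fan.toLMS.map α.act) (Fans.Fan.toLMS.map α.proj)
      (Fans.Fan.toLMS.map q') := Fans.LMS.isQuotient hq hgeom.isHomeomorph.surjective
  refine ⟨hgeom.isHomeomorph, hL, Fans.Fan.isQuotient hL, fun P _ j hj => ?_⟩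
  obtain ⟨a, ha⟩ := α.exists_restrictsTo hj
  obtain ⟨j', hj', e⟩ := α.exists_isOpenImmersion hA hgeom hj ha
  refine ⟨a, ha, ObjectProperty.homMk ⟨j', Fans.MS.localMor_of_isOpenImmersion j'⟩, hj',
    Fans.Fan.hom_ext e, ?_⟩
  -- As `Spec P ⟶ Spec P'` is surjective, `j'` has the same image as its composite with it, which is
  -- `j ≫ q`.
  have hsurj := (Fans.Spec.isHomeomorph_comap_mker a hA).surjective
  refine (hsurj.range_comp (Fans.MS.pt j')).symm.trans ?_
  refine Eq.trans ?_ (Set.range_comp _ _)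
  exact congrArg Set.range (funext fun F => (Fans.MS.pt_congr e F).symm)
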